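/- All tensor products are Hilbert space tensor products, $\Sigma$ is the tensor flip, and leg numbering notation is used. Let $\mathcal H\neq0$ and $\mathcal L$ be Hilbert spaces and let $(\mathbb W,\mathbb U,\mathbb V,\mathbb F)$ be a (top-)braided multiplicative unitary. That is, $\mathbb W\in\mathcal U(\mathcal H\otimes\mathcal H)$, $\mathbb U\in\mathcal U(\mathcal L\otimes\mathcal H)$, $\mathbb V\in\mathcal U(\mathcal H\otimes\mathcal L)$, $\mathbb F\in\mathcal U(\mathcal L\otimes\mathcal L)$ are unitaries with $\mathbb W_{23}\mathbb W_{12}=\mathbb W_{12}\mathbb W_{13}\mathbb W_{23}$, $\mathbb W_{23}\mathbb U_{12}=\mathbb U_{12}\mathbb U_{13}\mathbb W_{23}$, $\mathbb V_{23}\mathbb W_{12}=\mathbb W_{12}\mathbb V_{13}\mathbb V_{23}$, $\mathbb V_{12}\mathbb W_{13}\mathbb U_{23}=\mathbb U_{23}\mathbb W_{13}\mathbb V_{12}$ (on $\mathcal H\otimes\mathcal L\otimes\mathcal H$), $\mathbb U_{13}\mathbb U_{23}\mathbb F_{12}=\mathbb F_{12}\mathbb U_{13}\mathbb U_{23}$,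 $\mathbb V_{13}\mathbb V_{12}\mathbb F_{23}=\mathbb F_{23}\mathbb V_{13}\mathbb V_{12}$, and $\mathbb F_{23}\mathbb F_{12}=\mathbb F_{12}\,c^{\mathcal L}_{23}\,\mathbb F_{12}\,(c^{\mathcal L}_{23})^{-1}\,\mathbb F_{23}$. Here, for a right representation $S\in\mathcal U(K\otimes\mathcal H)$ of $\mathbb W$ (so $\mathbb W_{23}S_{12}=S_{12}S_{13}\mathbb W_{23}$), the braiding operator is $c^{K}=Z\Sigma\colon\mathcal L\otimes K\to K\otimes\mathcal L$ for the unique unitary $Z\in\mathcal U(K\otimes\mathcal L)$ with $Z_{13}=\mathbb V_{23}S_{12}^*\mathbb V_{23}^*S_{12}$ on $K\otimes\mathcal H\otimes\mathcal L$, and $c^{\mathcal L}$ belongs to $S=\mathbb U$; it is assumed that $c^{\mathcal L}$ is defined, that is, that this $Z$ exists for $S=\mathbb U$. A representation of $(\mathbb W,\mathbb U,\mathbb V,\mathbb F)$ is a triple $(K,S,T)$ with a Hilbert space $K$, a right representation $S\in\mathcal U(K\otimes\mathcal H)$ of $\mathbb W$ for which the braiding operator $c^K$ is defined, and $T\in\mathcal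 U(K\otimes\mathcal L)$ with $S_{13}\mathbb U_{23}T_{12}=T_{12}S_{13}\mathbb U_{23}$ and $\mathbb F_{23}T_{12}=T_{12}\,c^{\mathcal L}_{23}\,T_{12}\,(c^{\mathcal L}_{23})^{-1}\,\mathbb F_{23}$. Arrows $(K_1,S_1,T_1)\to(K_2,S_2,T_2)$ are the bounded operators $a\colon K_1\to K_2$ with $(a\otimes1)S_1=S_2(a\otimes1)$ and $(a\otimes1)T_1=T_2(a\otimes1)$. Put $\tau(K)=(K,1,1)$ and $\tau(x)=\tau(K)$ for $x=(K,S,T)$, and $$(K_1,S_1,T_1)\otimes(K_2,S_2,T_2)=\bigl(K_1\otimes K_2,\ (S_1)_{13}(S_2)_{23},\ T_1\top T_2\bigr),\qquad T_1\top T_2=c^{K_2}_{23}\,(T_1)_{12}\,(c^{K_2}_{23})^{-1}\,(T_2)_{23}.$$ Then the following hold. (a) The representations of $(\mathbb W,\mathbb U,\mathbb V,\mathbb F)$ form a Hilbert space tensor category. That is: the spaces of arrows are weakly closed linear spaces of operators, contain the identities and are closed under composition and adjoints; two representations on the same Hilbert space between which the identity operator is an arrow are equal; the $\tau(K)$ are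 representations, and every bounded operator $K_1\to K_2$ is an arrow $\tau(K_1)\to\tau(K_2)$; tensor products of representations are representations, tensor products of arrows are arrows, $\tau(K_1)\otimes\tau(K_2)=\tau(K_1\otimes K_2)$; the associators of Hilbert spaces and the unit transformations $K\cong\mathbb C\otimes K$, $K\cong K\otimes\mathbb C$ (with $\mathbb C$ carrying $\tau(\mathbb C)$) are arrows; and if $a\otimes\mathrm{id}$ is an arrow $x_1\otimes y\to x_2\otimes y$ or $\mathrm{id}\otimes a$ is an arrow $y\otimes x_1\to y\otimes x_2$ for some representation $y$ on a nonzero Hilbert space, then $a$ is an arrow $x_1\to x_2$. (b) The triple $\rho=(\mathcal H,\mathbb W,1)\otimes(\mathcal L,\mathbb U,\mathbb F)=(\mathcal H\otimes\mathcal L,\ \mathbb W_{13}\mathbb U_{23},\ 1\top\mathbb F)$ is a representation, and $\rho$ together with the unitaries $$A^x=S_{12}\,(T\top 1_{\mathcal H})\in\mathcal U(K\otimes\mathcal H\otimes\mathcal L),\qquad x=(K,S,T),$$ where $T\top1_{\mathcal H}$ is the second unitary of $x\otimes(\mathcal H,\mathbb W,1)$, is a natural right absorber (a regular object in the sense of Pinzari–Roberts):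 each $A^x$ is an arrow $x\otimes\rho\to\tau(x)\otimes\rho$; $(a\otimes\mathrm{id}_\rho)A^{x_1}=A^{x_2}(a\otimes\mathrm{id}_\rho)$ for every arrow $a\colon x_1\to x_2$; and $A^{x_1\otimes x_2}=A^{x_1}_{13}A^{x_2}_{23}$ for all representations $x_1,x_2$. -/

import Mathlib

open scoped TensorProduct InnerProductSpace
open UniformSpace

universe u

/-- The Hilbert space tensor product: the completion of the algebraic tensor product with the
inner product determined by `⟪x ⊗ y, x' ⊗ y'⟫ = ⟪x, x'⟫ ⟪y, y'⟫`. -/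
def HTensor (E F : Type*) [NormedAddCommGroup E] [InnerProductSpace ℂ E]
    [NormedAddCommGroup F] [InnerProductSpace ℂ F] : Type _ :=
  Completion (E ⊗[ℂ] F)

namespace HTensor

noncomputable section

variable {E F G E' F' : Type*}
  [NormedAddCommGroup E] [InnerProductSpace ℂ E]
  [NormedAddCommGroup F] [InnerProductSpace ℂ F]
  [NormedAddCommGroup G] [InnerProductSpace ℂ G]
  [NormedAddCommGroup E'] [InnerProductSpace ℂ E']
  [NormedAddCommGroup F'] [InnerProductSpace ℂ F']

instance : NormedAddCommGroup (HTensor E F) :=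
  inferInstanceAs (NormedAddCommGroup (Completion (E ⊗[ℂ] F)))

instance : InnerProductSpace ℂ (HTensor E F) :=
  inferInstanceAs (InnerProductSpace ℂ (Completion (E ⊗[ℂ] F)))

instance : CompleteSpace (HTensor E F) :=
  inferInstanceAs (CompleteSpace (Completion (E ⊗[ℂ] F)))

variable (E F) in
/-- The canonical isometric embedding of the algebraic tensor product. -/
def incl : E ⊗[ℂ] F →ₗᵢ[ℂ] HTensor E F :=
  (Completion.toComplₗᵢ : E ⊗[ℂ] F →ₗᵢ[ℂ] Completion (E ⊗[ℂ] F))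

theorem denseRange_incl : DenseRange (incl E F) :=
  Completion.denseRange_coe

/-- The tensor product `f ⊗ g` of two unitaries. -/
def congr (f : E ≃ₗᵢ[ℂ] E') (g : F ≃ₗᵢ[ℂ] F') : HTensor E F ≃ₗᵢ[ℂ] HTensor E' F' :=
  (TensorProduct.congrIsometry f g).toLinearEquiv.extendOfIsometry
    (incl E F).toLinearMap (incl E' F').toLinearMap denseRange_incl denseRange_incl
    (fun x => by
      rw [LinearIsometry.coe_toLinearMap, LinearIsometry.coe_toLinearMap,
        LinearIsometry.norm_map, LinearIsometry.norm_map]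
      exact (TensorProduct.congrIsometry f g).norm_map x)

variable (E F) in
/-- The tensor flip `Σ (x ⊗ y) = y ⊗ x`. -/
def flip : HTensor E F ≃ₗᵢ[ℂ] HTensor F E :=
  (TensorProduct.commIsometry ℂ E F).toLinearEquiv.extendOfIsometry
    (incl E F).toLinearMap (incl F E).toLinearMap denseRange_incl denseRange_incl
    (fun x => by
      rw [LinearIsometry.coe_toLinearMap, LinearIsometry.coe_toLinearMap,
        LinearIsometry.norm_map, LinearIsometry.norm_map]
      exact (TensorProduct.commIsometry ℂ E F).norm_map x)

theorem denseRange_mapIsometry (f : E →ₗᵢ[ℂ] E') (g : F →ₗᵢ[ℂ] F')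
    (hf : DenseRange f) (hg : DenseRange g) :
    DenseRange ((incl E' F').comp
      (TensorProduct.mapIsometry f g)).toLinearMap := by
  have h : DenseRange (TensorProduct.mapIsometry f g) := by
    intro z
    change z ∈ closure (Set.range (TensorProduct.mapIsometry f g).toLinearMap)
    rw [← LinearMap.coe_range, ← Submodule.topologicalClosure_coe, SetLike.mem_coe]
    induction z with
    | zero => exact zero_mem _
    | add x y hx hy => exact add_mem hx hy
    | tmul x y =>
      refine (hf.prodMap hg).induction_on
        (p := fun q : E' × F' => q.1 ⊗ₜ[ℂ] q.2 ∈
          (LinearMap.range (TensorProduct.mapIsometry f g).toLinearMap).topologicalClosure)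
        (x, y) ?_ ?_
      · exact (Submodule.isClosed_topologicalClosure _).preimage TensorProduct.continuous_tmul
      · rintro ⟨a, b⟩
        exact Submodule.le_topologicalClosure _ ⟨a ⊗ₜ b, by simp⟩
  exact denseRange_incl.comp h (incl E' F').continuous

variable (E F G) in
/-- The associator `(x ⊗ y) ⊗ z ↦ x ⊗ (y ⊗ z)`. -/
def assoc : HTensor (HTensor E F) G ≃ₗᵢ[ℂ] HTensor E (HTensor F G) :=
  (TensorProduct.assocIsometry ℂ E F G).toLinearEquiv.extendOfIsometry
    ((incl (HTensor E F) G).comp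
      (TensorProduct.mapIsometry (incl E F) LinearIsometry.id)).toLinearMap
    ((incl E (HTensor F G)).comp
      (TensorProduct.mapIsometry LinearIsometry.id (incl F G))).toLinearMap
    (denseRange_mapIsometry _ _ denseRange_incl Function.surjective_id.denseRange)
    (denseRange_mapIsometry _ _ Function.surjective_id.denseRange denseRange_incl)
    (fun x => by
      rw [LinearIsometry.coe_toLinearMap, LinearIsometry.coe_toLinearMap,
        LinearIsometry.norm_map, LinearIsometry.norm_map]
      exact (TensorProduct.assocIsometry ℂ E F G).norm_map x)

theorem norm_sq_sum_tmul {ι : Type*} [Fintype ι] (c : ι → E) {f : ι → F}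
    (hf : Orthonormal ℂ f) : ‖∑ i, c i ⊗ₜ[ℂ] f i‖ ^ 2 = ∑ i, ‖c i‖ ^ 2 := by
  classical
  have h : (inner ℂ (∑ i, c i ⊗ₜ[ℂ] f i) (∑ i, c i ⊗ₜ[ℂ] f i) : ℂ)
      = ∑ i, inner ℂ (c i) (c i) := by
    simp only [sum_inner, inner_sum, TensorProduct.inner_tmul]
    refine Finset.sum_congr rfl fun i _ => ?_
    simp_rw [orthonormal_iff_ite.mp hf]
    simp
  have h' := (inner_self_eq_norm_sq_to_K (𝕜 := ℂ) (∑ i, c i ⊗ₜ[ℂ] f i)).symm.trans h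
  simp_rw [inner_self_eq_norm_sq_to_K] at h'
  exact_mod_cast h'

theorem norm_rTensor_le (a : E →L[ℂ] E') (x : E ⊗[ℂ] F) :
    ‖LinearMap.rTensor F a.toLinearMap x‖ ≤ ‖a‖ * ‖x‖ := by
  obtain ⟨E₀, F₀, -, iF, hz⟩ :=
    TensorProduct.exists_finite_submodule_of_setFinite {x} (Set.finite_singleton x)
  obtain ⟨y, rfl⟩ := Set.singleton_subset_iff.mp hz
  let f := stdOrthonormalBasis ℂ F₀
  obtain ⟨b, rfl⟩ := TensorProduct.eq_repr_basis_right f.toBasis y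
  have h1 : TensorProduct.mapIncl E₀ F₀ (b.sum fun i m => m ⊗ₜ[ℂ] f.toBasis i)
      = ∑ i, ((b i : E₀) : E) ⊗ₜ[ℂ] (f i : F) := by
    rw [Finsupp.sum_fintype _ _ (by simp)]
    simp [TensorProduct.mapIncl]
  rw [h1, map_sum]
  simp only [LinearMap.rTensor_tmul]
  refine le_of_sq_le_sq ?_ (by positivity)
  have hf : Orthonormal ℂ (fun i => (f i : F)) :=
    f.orthonormal.comp_linearIsometry F₀.subtypeₗᵢ
  rw [mul_pow, norm_sq_sum_tmul _ hf, norm_sq_sum_tmul _ hf, Finset.mul_sum]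
  refine Finset.sum_le_sum fun i _ => ?_
  rw [← mul_pow]
  exact pow_le_pow_left₀ (norm_nonneg _) (a.le_opNorm _) 2

theorem norm_map_le (a : E →L[ℂ] E') (b : F →L[ℂ] F') (x : E ⊗[ℂ] F) :
    ‖TensorProduct.map a.toLinearMap b.toLinearMap x‖ ≤ ‖a‖ * ‖b‖ * ‖x‖ := by
  have h : TensorProduct.map a.toLinearMap b.toLinearMap x =
      LinearMap.rTensor F' a.toLinearMap (TensorProduct.comm ℂ F' E
        (LinearMap.rTensor E b.toLinearMap (TensorProduct.comm ℂ E F x))) := by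
    induction x with
    | zero => simp
    | add x y hx hy => simp only [map_add, hx, hy]
    | tmul x y => simp
  rw [h, mul_assoc]
  refine (norm_rTensor_le _ _).trans (mul_le_mul_of_nonneg_left ?_ (norm_nonneg _))
  rw [TensorProduct.norm_comm]
  exact (norm_rTensor_le _ _).trans (by rw [TensorProduct.norm_comm])

/-- The tensor product `a ⊗ b` of two bounded operators. -/
def map (a : E →L[ℂ] E') (b : F →L[ℂ] F') : HTensor E F →L[ℂ] HTensor E' F' :=
  (((incl E' F').toLinearMap ∘ₗ TensorProduct.map a.toLinearMap b.toLinearMap)).extendOfNorm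
    (incl E F).toLinearMap

/-- The elementary tensor `x ⊗ y` in the Hilbert space tensor product. -/
def tmul (x : E) (y : F) : HTensor E F := incl E F (x ⊗ₜ[ℂ] y)

theorem map_tmul (a : E →L[ℂ] E') (b : F →L[ℂ] F') (x : E) (y : F) :
    map a b (tmul x y) = tmul (a x) (b y) :=
  LinearMap.extendOfNorm_eq (e := (incl E F).toLinearMap) denseRange_incl
    ⟨‖a‖ * ‖b‖, fun z => by
      simpa only [LinearMap.comp_apply, LinearIsometry.coe_toLinearMap,
        LinearIsometry.norm_map] using norm_map_le a b z⟩ (x ⊗ₜ[ℂ] y)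

theorem congr_tmul (f : E ≃ₗᵢ[ℂ] E') (g : F ≃ₗᵢ[ℂ] F') (x : E) (y : F) :
    congr f g (tmul x y) = tmul (f x) (g y) :=
  LinearEquiv.extendOfIsometry_eq _ _ _ _ _ _ (x ⊗ₜ[ℂ] y)

theorem flip_tmul (x : E) (y : F) : flip E F (tmul x y) = tmul y x :=
  LinearEquiv.extendOfIsometry_eq _ _ _ _ _ _ (x ⊗ₜ[ℂ] y)

theorem assoc_tmul (x : E) (y : F) (z : G) :
    assoc E F G (tmul (tmul x y) z) = tmul x (tmul y z) :=
  LinearEquiv.extendOfIsometry_eq _ _ _ _ _ _ ((x ⊗ₜ[ℂ] y) ⊗ₜ[ℂ] z)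

end

end HTensor

namespace HTensor

noncomputable section

variable {A B C A' B' C' : Type*}
  [NormedAddCommGroup A] [InnerProductSpace ℂ A]
  [NormedAddCommGroup B] [InnerProductSpace ℂ B]
  [NormedAddCommGroup C] [InnerProductSpace ℂ C]
  [NormedAddCommGroup A'] [InnerProductSpace ℂ A']
  [NormedAddCommGroup B'] [InnerProductSpace ℂ B']
  [NormedAddCommGroup C'] [InnerProductSpace ℂ C']

variable (C) in
/-- Leg numbering: `T₁₂ = T ⊗ 1` on `A ⊗ B ⊗ C`. -/
def leg12 (T : HTensor A B ≃ₗᵢ[ℂ] HTensor A' B') :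
    HTensor (HTensor A B) C ≃ₗᵢ[ℂ] HTensor (HTensor A' B') C :=
  congr T (LinearIsometryEquiv.refl ℂ C)

variable (A) in
/-- Leg numbering: `T₂₃ = 1 ⊗ T` on `A ⊗ B ⊗ C`. -/
def leg23 (T : HTensor B C ≃ₗᵢ[ℂ] HTensor B' C') :
    HTensor (HTensor A B) C ≃ₗᵢ[ℂ] HTensor (HTensor A B') C' :=
  ((assoc A B C).trans (congr (LinearIsometryEquiv.refl ℂ A) T)).trans (assoc A B' C').symm

variable (B) in
/-- Leg numbering: `T₁₃ = Σ₂₃ T₁₂ Σ₂₃` on `A ⊗ B ⊗ C`. -/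
def leg13 (T : HTensor A C ≃ₗᵢ[ℂ] HTensor A' C') :
    HTensor (HTensor A B) C ≃ₗᵢ[ℂ] HTensor (HTensor A' B) C' :=
  ((leg23 A (flip B C)).trans (leg12 B T)).trans (leg23 A' (flip C' B))

/-- The unitary `Y X Y⁻¹`. -/
def conjBy (Y : A ≃ₗᵢ[ℂ] B) (X : A ≃ₗᵢ[ℂ] A) : B ≃ₗᵢ[ℂ] B :=
  (Y.symm.trans X).trans Y

/-- A unitary viewed as a bounded operator. -/
abbrev toOp (X : A ≃ₗᵢ[ℂ] B) : A →L[ℂ] B := (X.toContinuousLinearEquiv : A →L[ℂ] B)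

end

end HTensor

open HTensor

/-- The underlying data of a W*-category of Hilbert spaces with extra structure that carries a
tensor product. An object is a Hilbert space `K` with a structure `s : Str K` such that `IsObj s`;
the forgetful functor sends it to `K`. Since arrows are bounded operators and the tensor product of
two structures lives on the Hilbert space tensor product, the forgetful functor is faithful and
strictly monoidal by construction. `triv K` is the trivial structure `τ K`, and `τ` is the
identity on arrows. -/
structure TensorData where
  Str : ∀ (K : Type u) [NormedAddCommGroup K] [InnerProductSpace ℂ K] [CompleteSpace K], Type u
  IsObj : ∀ {K : Type u} [NormedAddCommGroup K] [InnerProductSpace ℂ K] [CompleteSpace K],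
    Str K → Prop
  Hom : ∀ {K₁ K₂ : Type u}
    [NormedAddCommGroup K₁] [InnerProductSpace ℂ K₁] [CompleteSpace K₁]
    [NormedAddCommGroup K₂] [InnerProductSpace ℂ K₂] [CompleteSpace K₂],
    Str K₁ → Str K₂ → Set (K₁ →L[ℂ] K₂)
  triv : ∀ (K : Type u) [NormedAddCommGroup K] [InnerProductSpace ℂ K] [CompleteSpace K], Str K
  tensor : ∀ {K₁ K₂ : Type u}
    [NormedAddCommGroup K₁] [InnerProductSpace ℂ K₁] [CompleteSpace K₁]
    [NormedAddCommGroup K₂] [InnerProductSpace ℂ K₂] [CompleteSpace K₂],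
    Str K₁ → Str K₂ → Str (HTensor K₁ K₂)

namespace TensorData

/-- The one-dimensional Hilbert space, the tensor unit. -/
abbrev UnitSpace : Type u := EuclideanSpace ℂ PUnit.{u + 1}

/-- The unit vector `1` of the tensor unit. -/
noncomputable abbrev unitVec : UnitSpace.{u} := EuclideanSpace.single PUnit.unit 1

/-- The unit transformation `K → ℂ ⊗ K`, `ξ ↦ 1 ⊗ ξ`. -/
noncomputable def leftUnit (K : Type u) [NormedAddCommGroup K] [InnerProductSpace ℂ K] :
    K →L[ℂ] HTensor UnitSpace.{u} K :=
  (incl UnitSpace.{u} K).toContinuousLinearMap ∘L TensorProduct.mkL ℂ UnitSpace.{u} K unitVec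

/-- The unit transformation `K → K ⊗ ℂ`, `ξ ↦ ξ ⊗ 1`. -/
noncomputable def rightUnit (K : Type u) [NormedAddCommGroup K] [InnerProductSpace ℂ K] :
    K →L[ℂ] HTensor K UnitSpace.{u} :=
  (incl K UnitSpace.{u}).toContinuousLinearMap ∘L
    (TensorProduct.mkL ℂ K UnitSpace.{u}).flip unitVec

/-- The axioms of a Hilbert space tensor category: a W*-category of Hilbert spaces with extra
structure (arrow spaces are weakly closed linear spaces of operators, closed under composition and
adjoints), monoidal with the associators and unit transformations of Hilbert spaces, with the
strict monoidal functor `τ`, such that structures are determined by their arrows and arrows may be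
cancelled from tensor products with (nonzero) objects. -/
structure IsHilbertSpaceTensorCategory (D : TensorData.{u}) : Prop where
  id_mem : ∀ {K : Type u} [NormedAddCommGroup K] [InnerProductSpace ℂ K] [CompleteSpace K]
    {s : D.Str K}, D.IsObj s → ContinuousLinearMap.id ℂ K ∈ D.Hom s s
  comp_mem : ∀ {K₁ K₂ K₃ : Type u}
    [NormedAddCommGroup K₁] [InnerProductSpace ℂ K₁] [CompleteSpace K₁]
    [NormedAddCommGroup K₂] [InnerProductSpace ℂ K₂] [CompleteSpace K₂]
    [NormedAddCommGroup K₃] [InnerProductSpace ℂ K₃] [CompleteSpace K₃]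
    {s₁ : D.Str K₁} {s₂ : D.Str K₂} {s₃ : D.Str K₃},
    D.IsObj s₁ → D.IsObj s₂ → D.IsObj s₃ →
    ∀ {a : K₁ →L[ℂ] K₂} {b : K₂ →L[ℂ] K₃}, a ∈ D.Hom s₁ s₂ → b ∈ D.Hom s₂ s₃ →
      b ∘L a ∈ D.Hom s₁ s₃
  zero_mem : ∀ {K₁ K₂ : Type u}
    [NormedAddCommGroup K₁] [InnerProductSpace ℂ K₁] [CompleteSpace K₁]
    [NormedAddCommGroup K₂] [InnerProductSpace ℂ K₂] [CompleteSpace K₂]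
    {s₁ : D.Str K₁} {s₂ : D.Str K₂}, D.IsObj s₁ → D.IsObj s₂ → 0 ∈ D.Hom s₁ s₂
  add_mem : ∀ {K₁ K₂ : Type u}
    [NormedAddCommGroup K₁] [InnerProductSpace ℂ K₁] [CompleteSpace K₁]
    [NormedAddCommGroup K₂] [InnerProductSpace ℂ K₂] [CompleteSpace K₂]
    {s₁ : D.Str K₁} {s₂ : D.Str K₂}, D.IsObj s₁ → D.IsObj s₂ →
    ∀ {a b : K₁ →L[ℂ] K₂}, a ∈ D.Hom s₁ s₂ → b ∈ D.Hom s₁ s₂ → a + b ∈ D.Hom s₁ s₂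
  smul_mem : ∀ {K₁ K₂ : Type u}
    [NormedAddCommGroup K₁] [InnerProductSpace ℂ K₁] [CompleteSpace K₁]
    [NormedAddCommGroup K₂] [InnerProductSpace ℂ K₂] [CompleteSpace K₂]
    {s₁ : D.Str K₁} {s₂ : D.Str K₂}, D.IsObj s₁ → D.IsObj s₂ →
    ∀ (c : ℂ) {a : K₁ →L[ℂ] K₂}, a ∈ D.Hom s₁ s₂ → c • a ∈ D.Hom s₁ s₂
  adjoint_mem : ∀ {K₁ K₂ : Type u}
    [NormedAddCommGroup K₁] [InnerProductSpace ℂ K₁] [CompleteSpace K₁]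
    [NormedAddCommGroup K₂] [InnerProductSpace ℂ K₂] [CompleteSpace K₂]
    {s₁ : D.Str K₁} {s₂ : D.Str K₂}, D.IsObj s₁ → D.IsObj s₂ →
    ∀ {a : K₁ →L[ℂ] K₂}, a ∈ D.Hom s₁ s₂ → ContinuousLinearMap.adjoint a ∈ D.Hom s₂ s₁
  weakly_closed : ∀ {K₁ K₂ : Type u}
    [NormedAddCommGroup K₁] [InnerProductSpace ℂ K₁] [CompleteSpace K₁]
    [NormedAddCommGroup K₂] [InnerProductSpace ℂ K₂] [CompleteSpace K₂]
    {s₁ : D.Str K₁} {s₂ : D.Str K₂}, D.IsObj s₁ → D.IsObj s₂ →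
    IsClosed {a : K₁ →WOT[ℂ] K₂ | a.toCLM ∈ D.Hom s₁ s₂}
  eq_of_id_mem : ∀ {K : Type u} [NormedAddCommGroup K] [InnerProductSpace ℂ K] [CompleteSpace K]
    {s s' : D.Str K}, D.IsObj s → D.IsObj s' → ContinuousLinearMap.id ℂ K ∈ D.Hom s s' → s = s'
  isObj_triv : ∀ (K : Type u) [NormedAddCommGroup K] [InnerProductSpace ℂ K] [CompleteSpace K],
    D.IsObj (D.triv K)
  hom_triv : ∀ {K₁ K₂ : Type u}
    [NormedAddCommGroup K₁] [InnerProductSpace ℂ K₁] [CompleteSpace K₁]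
    [NormedAddCommGroup K₂] [InnerProductSpace ℂ K₂] [CompleteSpace K₂]
    (a : K₁ →L[ℂ] K₂), a ∈ D.Hom (D.triv K₁) (D.triv K₂)
  isObj_tensor : ∀ {K₁ K₂ : Type u}
    [NormedAddCommGroup K₁] [InnerProductSpace ℂ K₁] [CompleteSpace K₁]
    [NormedAddCommGroup K₂] [InnerProductSpace ℂ K₂] [CompleteSpace K₂]
    {s₁ : D.Str K₁} {s₂ : D.Str K₂}, D.IsObj s₁ → D.IsObj s₂ → D.IsObj (D.tensor s₁ s₂)
  map_mem : ∀ {K₁ K₂ K₁' K₂' : Type u}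
    [NormedAddCommGroup K₁] [InnerProductSpace ℂ K₁] [CompleteSpace K₁]
    [NormedAddCommGroup K₂] [InnerProductSpace ℂ K₂] [CompleteSpace K₂]
    [NormedAddCommGroup K₁'] [InnerProductSpace ℂ K₁'] [CompleteSpace K₁']
    [NormedAddCommGroup K₂'] [InnerProductSpace ℂ K₂'] [CompleteSpace K₂']
    {s₁ : D.Str K₁} {s₂ : D.Str K₂} {s₁' : D.Str K₁'} {s₂' : D.Str K₂'},
    D.IsObj s₁ → D.IsObj s₂ → D.IsObj s₁' → D.IsObj s₂' →
    ∀ {a : K₁ →L[ℂ] K₁'} {b : K₂ →L[ℂ] K₂'}, a ∈ D.Hom s₁ s₁' → b ∈ D.Hom s₂ s₂' →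
      HTensor.map a b ∈ D.Hom (D.tensor s₁ s₂) (D.tensor s₁' s₂')
  tensor_triv : ∀ (K₁ K₂ : Type u)
    [NormedAddCommGroup K₁] [InnerProductSpace ℂ K₁] [CompleteSpace K₁]
    [NormedAddCommGroup K₂] [InnerProductSpace ℂ K₂] [CompleteSpace K₂],
    D.tensor (D.triv K₁) (D.triv K₂) = D.triv (HTensor K₁ K₂)
  assoc_mem : ∀ {K₁ K₂ K₃ : Type u}
    [NormedAddCommGroup K₁] [InnerProductSpace ℂ K₁] [CompleteSpace K₁]
    [NormedAddCommGroup K₂] [InnerProductSpace ℂ K₂] [CompleteSpace K₂]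
    [NormedAddCommGroup K₃] [InnerProductSpace ℂ K₃] [CompleteSpace K₃]
    {s₁ : D.Str K₁} {s₂ : D.Str K₂} {s₃ : D.Str K₃},
    D.IsObj s₁ → D.IsObj s₂ → D.IsObj s₃ →
    toOp (HTensor.assoc K₁ K₂ K₃) ∈
      D.Hom (D.tensor (D.tensor s₁ s₂) s₃) (D.tensor s₁ (D.tensor s₂ s₃))
  leftUnit_mem : ∀ {K : Type u} [NormedAddCommGroup K] [InnerProductSpace ℂ K] [CompleteSpace K]
    {s : D.Str K}, D.IsObj s → leftUnit K ∈ D.Hom s (D.tensor (D.triv UnitSpace.{u}) s)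
  rightUnit_mem : ∀ {K : Type u} [NormedAddCommGroup K] [InnerProductSpace ℂ K] [CompleteSpace K]
    {s : D.Str K}, D.IsObj s → rightUnit K ∈ D.Hom s (D.tensor s (D.triv UnitSpace.{u}))
  cancel_right : ∀ {K₁ K₂ Y : Type u}
    [NormedAddCommGroup K₁] [InnerProductSpace ℂ K₁] [CompleteSpace K₁]
    [NormedAddCommGroup K₂] [InnerProductSpace ℂ K₂] [CompleteSpace K₂]
    [NormedAddCommGroup Y] [InnerProductSpace ℂ Y] [CompleteSpace Y] [Nontrivial Y]
    {s₁ : D.Str K₁} {s₂ : D.Str K₂} {y : D.Str Y},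
    D.IsObj s₁ → D.IsObj s₂ → D.IsObj y → ∀ {a : K₁ →L[ℂ] K₂},
    HTensor.map a (ContinuousLinearMap.id ℂ Y) ∈ D.Hom (D.tensor s₁ y) (D.tensor s₂ y) →
      a ∈ D.Hom s₁ s₂
  cancel_left : ∀ {K₁ K₂ Y : Type u}
    [NormedAddCommGroup K₁] [InnerProductSpace ℂ K₁] [CompleteSpace K₁]
    [NormedAddCommGroup K₂] [InnerProductSpace ℂ K₂] [CompleteSpace K₂]
    [NormedAddCommGroup Y] [InnerProductSpace ℂ Y] [CompleteSpace Y] [Nontrivial Y]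
    {s₁ : D.Str K₁} {s₂ : D.Str K₂} {y : D.Str Y},
    D.IsObj s₁ → D.IsObj s₂ → D.IsObj y → ∀ {a : K₁ →L[ℂ] K₂},
    HTensor.map (ContinuousLinearMap.id ℂ Y) a ∈ D.Hom (D.tensor y s₁) (D.tensor y s₂) →
      a ∈ D.Hom s₁ s₂

/-- A natural right absorber (a regular object in the sense of Pinzari and Roberts): an object `ρ`
with unitary arrows `A x : x ⊗ ρ → τ x ⊗ ρ` that are natural in `x` and satisfy
`A (x₁ ⊗ x₂) = (A x₁)₁₃ (A x₂)₂₃`. -/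
structure IsNaturalRightAbsorber (D : TensorData.{u}) {R : Type u}
    [NormedAddCommGroup R] [InnerProductSpace ℂ R] [CompleteSpace R] (ρ : D.Str R)
    (A : ∀ {K : Type u} [NormedAddCommGroup K] [InnerProductSpace ℂ K] [CompleteSpace K],
      D.Str K → (HTensor K R ≃ₗᵢ[ℂ] HTensor K R)) : Prop where
  isObj : D.IsObj ρ
  mem_hom : ∀ {K : Type u} [NormedAddCommGroup K] [InnerProductSpace ℂ K] [CompleteSpace K]
    {x : D.Str K}, D.IsObj x → toOp (A x) ∈ D.Hom (D.tensor x ρ) (D.tensor (D.triv K) ρ)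
  natural : ∀ {K₁ K₂ : Type u}
    [NormedAddCommGroup K₁] [InnerProductSpace ℂ K₁] [CompleteSpace K₁]
    [NormedAddCommGroup K₂] [InnerProductSpace ℂ K₂] [CompleteSpace K₂]
    {x₁ : D.Str K₁} {x₂ : D.Str K₂}, D.IsObj x₁ → D.IsObj x₂ →
    ∀ {a : K₁ →L[ℂ] K₂}, a ∈ D.Hom x₁ x₂ →
      HTensor.map a (ContinuousLinearMap.id ℂ R) ∘L toOp (A x₁) =
        toOp (A x₂) ∘L HTensor.map a (ContinuousLinearMap.id ℂ R)
  tensor : ∀ {K₁ K₂ : Type u}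
    [NormedAddCommGroup K₁] [InnerProductSpace ℂ K₁] [CompleteSpace K₁]
    [NormedAddCommGroup K₂] [InnerProductSpace ℂ K₂] [CompleteSpace K₂]
    {x₁ : D.Str K₁} {x₂ : D.Str K₂}, D.IsObj x₁ → D.IsObj x₂ →
      A (D.tensor x₁ x₂) = leg13 K₂ (A x₁) * leg23 K₁ (A x₂)

end TensorData

section Braiding

variable {H L K : Type*}
  [NormedAddCommGroup H] [InnerProductSpace ℂ H]
  [NormedAddCommGroup L] [InnerProductSpace ℂ L]
  [NormedAddCommGroup K] [InnerProductSpace ℂ K]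

/-- The pentagon equation `W₂₃ W₁₂ = W₁₂ W₁₃ W₂₃`. -/
def IsMultiplicativeUnitary (W : HTensor H H ≃ₗᵢ[ℂ] HTensor H H) : Prop :=
  leg23 H W * leg12 H W = leg12 H W * leg13 H W * leg23 H W

/-- Right representations of `W`: `W₂₃ S₁₂ = S₁₂ S₁₃ W₂₃` on `K ⊗ H ⊗ H`. -/
def IsRightRep (W : HTensor H H ≃ₗᵢ[ℂ] HTensor H H) (S : HTensor K H ≃ₗᵢ[ℂ] HTensor K H) : Prop :=
  leg23 K W * leg12 H S = leg12 H S * leg13 H S * leg23 K W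

/-- Left representations of `W`: `V₂₃ W₁₂ = W₁₂ V₁₃ V₂₃` on `H ⊗ H ⊗ L`. -/
def IsLeftRep (W : HTensor H H ≃ₗᵢ[ℂ] HTensor H H) (V : HTensor H L ≃ₗᵢ[ℂ] HTensor H L) : Prop :=
  leg23 H V * leg12 L W = leg12 L W * leg13 H V * leg23 H V

/-- The equation `Z₁₃ = V₂₃ (S₁₂)* (V₂₃)* S₁₂` on `K ⊗ H ⊗ L`; it determines `Z` if `H ≠ 0`. -/
def IsBraidingUnitary (V : HTensor H L ≃ₗᵢ[ℂ] HTensor H L) (S : HTensor K H ≃ₗᵢ[ℂ] HTensor K H)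
    (Z : HTensor K L ≃ₗᵢ[ℂ] HTensor K L) : Prop :=
  leg13 H Z = leg23 K V * (leg12 L S)⁻¹ * (leg23 K V)⁻¹ * leg12 L S

/-- The braiding operator between `L` and `K` is defined. -/
def HasBraiding (V : HTensor H L ≃ₗᵢ[ℂ] HTensor H L) (S : HTensor K H ≃ₗᵢ[ℂ] HTensor K H) : Prop :=
  ∃ Z, IsBraidingUnitary V S Z

open Classical in
/-- The unitary `Z` with `Z₁₃ = V₂₃ (S₁₂)* (V₂₃)* S₁₂` (only used where it exists). -/
noncomputable def braidingUnitary (V : HTensor H L ≃ₗᵢ[ℂ] HTensor H L)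
    (S : HTensor K H ≃ₗᵢ[ℂ] HTensor K H) : HTensor K L ≃ₗᵢ[ℂ] HTensor K L :=
  if h : HasBraiding V S then h.choose else 1

/-- The braiding operator `Z Σ : L ⊗ K → K ⊗ L`. Its inverse is the dual braiding operator. -/
noncomputable def braiding (V : HTensor H L ≃ₗᵢ[ℂ] HTensor H L)
    (S : HTensor K H ≃ₗᵢ[ℂ] HTensor K H) : HTensor L K ≃ₗᵢ[ℂ] HTensor K L :=
  (HTensor.flip L K).trans (braidingUnitary V S)

end Braiding

/-- A (top-)braided multiplicative unitary `(W, U, V, F)`: `W` is a multiplicative unitary on `H`,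
`L` carries a right representation `U` and a left representation `V` of `W` that satisfy the
Yetter–Drinfeld compatibility condition, and `F` is equivariant for `U` and `V` and satisfies the
braided pentagon equation; the braiding operator on `L ⊗ L` is part of that equation. -/
structure BraidedMultiplicativeUnitary (H L : Type u)
    [NormedAddCommGroup H] [InnerProductSpace ℂ H]
    [NormedAddCommGroup L] [InnerProductSpace ℂ L] where
  W : HTensor H H ≃ₗᵢ[ℂ] HTensor H H
  U : HTensor L H ≃ₗᵢ[ℂ] HTensor L H
  V : HTensor H L ≃ₗᵢ[ℂ] HTensor H L
  F : HTensor L L ≃ₗᵢ[ℂ] HTensor L L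
  pentagon : IsMultiplicativeUnitary W
  rightRep : IsRightRep W U
  leftRep : IsLeftRep W V
  /-- `V₁₂ W₁₃ U₂₃ = U₂₃ W₁₃ V₁₂` on `H ⊗ L ⊗ H`. -/
  yetterDrinfeld : leg12 H V * leg13 L W * leg23 H U = leg23 H U * leg13 L W * leg12 H V
  /-- `U₁₃ U₂₃ F₁₂ = F₁₂ U₁₃ U₂₃` on `L ⊗ L ⊗ H`. -/
  equivariant_right : leg13 L U * leg23 L U * leg12 H F = leg12 H F * (leg13 L U * leg23 L U)
  /-- `V₁₃ V₁₂ F₂₃ = F₂₃ V₁₃ V₁₂` on `H ⊗ L ⊗ L`. -/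
  equivariant_left : leg13 L V * leg12 L V * leg23 H F = leg23 H F * (leg13 L V * leg12 L V)
  hasBraiding : HasBraiding V U
  /-- The top-braided pentagon equation on `L ⊗ L ⊗ L`. -/
  braidedPentagon : leg23 L F * leg12 L F =
    leg12 L F * conjBy (leg23 L (braiding V U)) (leg12 L F) * leg23 L F

namespace BraidedMultiplicativeUnitary

noncomputable section

variable {H L : Type u}
  [NormedAddCommGroup H] [InnerProductSpace ℂ H]
  [NormedAddCommGroup L] [InnerProductSpace ℂ L]
  (B : BraidedMultiplicativeUnitary H L)

/-- A pair of unitaries `S` on `K ⊗ H` and `T` on `K ⊗ L`. -/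
@[ext]
structure PreRep (_B : BraidedMultiplicativeUnitary H L)
    (K : Type u) [NormedAddCommGroup K] [InnerProductSpace ℂ K] where
  S : HTensor K H ≃ₗᵢ[ℂ] HTensor K H
  T : HTensor K L ≃ₗᵢ[ℂ] HTensor K L

variable {K K₁ K₂ : Type u}
  [NormedAddCommGroup K] [InnerProductSpace ℂ K]
  [NormedAddCommGroup K₁] [InnerProductSpace ℂ K₁]
  [NormedAddCommGroup K₂] [InnerProductSpace ℂ K₂]

/-- Right representations `(K, S, T)` of `(W, U, V, F)`. The tensor product of representations
uses the braiding operators between `L` and `K`, so these are required to be defined. -/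
structure IsRep (x : B.PreRep K) : Prop where
  rightRep : IsRightRep B.W x.S
  hasBraiding : HasBraiding B.V x.S
  /-- `S₁₃ U₂₃ T₁₂ = T₁₂ S₁₃ U₂₃` on `K ⊗ L ⊗ H`. -/
  equivariant : leg13 L x.S * leg23 K B.U * leg12 H x.T =
    leg12 H x.T * (leg13 L x.S * leg23 K B.U)
  /-- The top-braided representation condition on `K ⊗ L ⊗ L`. -/
  braidedRep : leg23 K B.F * leg12 L x.T =
    leg12 L x.T * conjBy (leg23 K (braiding B.V B.U)) (leg12 L x.T) * leg23 K B.F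

/-- Intertwiners: `(a ⊗ 1) S₁ = S₂ (a ⊗ 1)` and `(a ⊗ 1) T₁ = T₂ (a ⊗ 1)`. -/
def Intertwiner (x₁ : B.PreRep K₁) (x₂ : B.PreRep K₂) : Set (K₁ →L[ℂ] K₂) :=
  {a | HTensor.map a (ContinuousLinearMap.id ℂ H) ∘L toOp x₁.S =
      toOp x₂.S ∘L HTensor.map a (ContinuousLinearMap.id ℂ H) ∧
    HTensor.map a (ContinuousLinearMap.id ℂ L) ∘L toOp x₁.T =
      toOp x₂.T ∘L HTensor.map a (ContinuousLinearMap.id ℂ L)}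

/-- The tensor product, with
`S = (S₁)₁₃ (S₂)₂₃` and `T = (braiding)₂₃ (T₁)₁₂ (dual braiding)₂₃ (T₂)₂₃`. -/
def tensorRep (x₁ : B.PreRep K₁) (x₂ : B.PreRep K₂) : B.PreRep (HTensor K₁ K₂) where
  S := leg13 K₂ x₁.S * leg23 K₁ x₂.S
  T := conjBy (leg23 K₁ (braiding B.V x₂.S)) (leg12 K₂ x₁.T) * leg23 K₁ x₂.T

/-- The tensor category of representations of `(W, U, V, F)`. -/
def corep : TensorData.{u} where
  Str K _ _ _ := B.PreRep K
  IsObj x := B.IsRep x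
  Hom x₁ x₂ := B.Intertwiner x₁ x₂
  triv _ _ _ _ := ⟨1, 1⟩
  tensor x₁ x₂ := B.tensorRep x₁ x₂

/-- The triple `(H, W, 1)`. -/
def regularRep : B.PreRep H := ⟨B.W, 1⟩

/-- The triple `(L, U, F)`. -/
def braidedRegularRep : B.PreRep L := ⟨B.U, B.F⟩

/-- `ρ = (H, W, 1) ⊗ (L, U, F)`, with underlying Hilbert space `H ⊗ L`. -/
def absorber : B.PreRep (HTensor H L) := B.tensorRep B.regularRep B.braidedRegularRep

/-- The absorbing intertwiner of `x = (K, S, T)` on `K ⊗ H ⊗ L`: the second unitary of the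
representation `x ⊗ (H, W, 1)` followed by `S₁₂`. -/
def absorbing (x : B.PreRep K) : HTensor K (HTensor H L) ≃ₗᵢ[ℂ] HTensor K (HTensor H L) :=
  conjBy (HTensor.assoc K H L) (leg12 L x.S * (B.tensorRep x B.regularRep).T)

end

end BraidedMultiplicativeUnitary

/-! Everything rests on the unitary `Z` behind the braiding. Its defining equation, written as V₂₃
S₁₂ = S₁₂ Z₁₃⁻¹ V₂₃, records what happens when V is pushed past S. It determines `Z` because H ≠ 0,
and it makes `Z` natural: an operator intertwining S₁ and S₂ also intertwines Z₁ and Z₂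
(`IsBraidingUnitary.intertwines`). Pushing V past two factors gives the hexagon identity, that
(S₁)₁₃(S₂)₂₃ has the braiding unitary (Z₂)₂₃(Z₁)₁₃ (`IsBraidingUnitary.tensor`).

The Yetter–Drinfeld condition makes `Z` itself an intertwiner (`IsBraidingUnitary.equivariant`), so
naturality applied to `Z` is the Yang–Baxter equation; applied to an equivariant T it is
`IsBraidingUnitary.commute_leg12`. Invariance of F under V gives `IsBraidingUnitary.commute_leg23`.
These relations and the conditions on T₁ and T₂ show that T₁ ⊤ T₂ satisfies the conditions on the
second unitary (`IsRep.tensor`). Associativity of ⊤ is the hexagon identity. Weak closedness holds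
because an intertwining relation can be tested on matrix coefficients.

For the absorber, the axioms of a representation x = (K, S, T) are read as statements about arrows.
The two conditions on T say that T is an arrow x ⊗ (L, U, F) → (K, S, 1) ⊗ (L, U, F). The condition
on S says that S is an arrow (K ⊗ H, S₁₃W₂₃, 1) → τ(K) ⊗ (H, W, 1). The first statement for x ⊗ (H,
W, 1), followed by the second tensored with the identity of (L, U, F), gives the arrow A^x. Since
the braiding unitary of W is V⁻¹, A^x is S₁₂ V₂₃⁻¹ T₁₃ V₂₃, and its multiplicativity reduces to the
equation defining `Z`.

All computations take place in groups of unitaries on four legs. The homomorphisms `leg134` and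
`leg234` carry the three-leg hypotheses there, and unitaries on disjoint legs commute. -/

namespace HTensor

/-! ### Elementary tensors, extensionality and leg numbering on three legs. -/

noncomputable section

variable {A B C D A' B' C' D' A'' B'' C'' X : Type*}
  [NormedAddCommGroup A] [InnerProductSpace ℂ A]
  [NormedAddCommGroup B] [InnerProductSpace ℂ B]
  [NormedAddCommGroup C] [InnerProductSpace ℂ C]
  [NormedAddCommGroup D] [InnerProductSpace ℂ D]
  [NormedAddCommGroup A'] [InnerProductSpace ℂ A']
  [NormedAddCommGroup B'] [InnerProductSpace ℂ B']
  [NormedAddCommGroup C'] [InnerProductSpace ℂ C']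
  [NormedAddCommGroup D'] [InnerProductSpace ℂ D']
  [NormedAddCommGroup A''] [InnerProductSpace ℂ A'']
  [NormedAddCommGroup B''] [InnerProductSpace ℂ B'']
  [NormedAddCommGroup C''] [InnerProductSpace ℂ C'']
  [NormedAddCommGroup X] [InnerProductSpace ℂ X]

/-- The bounded operator `y ↦ x ⊗ y`. -/
def tmulLeft (B : Type*) [NormedAddCommGroup B] [InnerProductSpace ℂ B] (x : A) :
    B →L[ℂ] HTensor A B :=
  (incl A B).toContinuousLinearMap ∘L TensorProduct.mkL ℂ A B x

/-- The bounded operator `x ↦ x ⊗ y`. -/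
def tmulRight (A : Type*) [NormedAddCommGroup A] [InnerProductSpace ℂ A] (y : B) :
    A →L[ℂ] HTensor A B :=
  (incl A B).toContinuousLinearMap ∘L (TensorProduct.mkL ℂ A B).flip y

theorem tmulRight_apply (x : A) (y : B) : tmulRight A y x = tmul x y := rfl

theorem tmul_add (x : A) (y y' : B) : tmul x (y + y') = tmul x y + tmul x y' :=
  map_add (tmulLeft B x) y y'

theorem add_tmul (x x' : A) (y : B) : tmul (x + x') y = tmul x y + tmul x' y :=
  map_add (tmulRight A y) x x'

theorem sub_tmul (x x' : A) (y : B) : tmul (x - x') y = tmul x y - tmul x' y :=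
  map_sub (tmulRight A y) x x'

theorem tmul_sub (x : A) (y y' : B) : tmul x (y - y') = tmul x y - tmul x y' :=
  map_sub (tmulLeft B x) y y'

theorem smul_tmul (c : ℂ) (x : A) (y : B) : tmul (c • x) y = c • tmul x y :=
  map_smul (tmulRight A y) c x

@[fun_prop]
theorem continuous_tmul {Y : Type*} [TopologicalSpace Y] {f : Y → A} {g : Y → B}
    (hf : Continuous f) (hg : Continuous g) : Continuous fun y => tmul (f y) (g y) :=
  (incl A B).continuous.comp (TensorProduct.continuous_tmul.comp (hf.prodMk hg))

theorem inner_tmul (x x' : A) (y y' : B) :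
    inner ℂ (tmul x y) (tmul x' y') = inner ℂ x x' * inner ℂ y y' := by
  rw [tmul, tmul, LinearIsometry.inner_map_map, TensorProduct.inner_tmul]

theorem norm_tmul (x : A) (y : B) : ‖tmul x y‖ = ‖x‖ * ‖y‖ := by
  rw [tmul, LinearIsometry.norm_map, TensorProduct.norm_tmul]

theorem tmul_right_cancel {x x' : A} {y : B} (hy : y ≠ 0) (h : tmul x y = tmul x' y) :
    x = x' := by
  rw [← sub_eq_zero, ← sub_tmul, ← norm_eq_zero, norm_tmul, mul_eq_zero, norm_eq_zero,
    norm_eq_zero] at h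
  exact sub_eq_zero.mp (h.resolve_right hy)

theorem tmul_left_cancel {x : A} {y y' : B} (hx : x ≠ 0) (h : tmul x y = tmul x y') :
    y = y' := by
  rw [← sub_eq_zero, ← tmul_sub, ← norm_eq_zero, norm_tmul, mul_eq_zero, norm_eq_zero,
    norm_eq_zero] at h
  exact sub_eq_zero.mp (h.resolve_left hx)

@[elab_as_elim]
theorem induction_on {p : HTensor A B → Prop} (x : HTensor A B) (closed : IsClosed {x | p x})
    (add : ∀ x y, p x → p y → p (x + y)) (tmul : ∀ a b, p (tmul a b)) : p x := by
  refine denseRange_incl.induction_on x closed fun z => ?_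
  induction z with
  -- Zero is the elementary tensor of zeros, which is why the induction principle has no separate
  -- case for it.
  | zero => simpa [HTensor.tmul] using tmul 0 0
  | tmul a b => exact tmul a b
  | add z w hz hw => simpa using add _ _ hz hw

theorem clm_ext {f g : HTensor A B →L[ℂ] X} (h : ∀ a b, f (tmul a b) = g (tmul a b)) : f = g :=
  ContinuousLinearMap.ext fun x => HTensor.induction_on x
    (isClosed_eq f.continuous g.continuous) (fun x y hx hy => by rw [map_add, map_add, hx, hy]) h

/-- Extensionality on the vectors `e (x ⊗ y)` for a unitary `e`. -/
theorem clm_ext_equiv (e : HTensor A B ≃ₗᵢ[ℂ] C) {f g : C →L[ℂ] X}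
    (h : ∀ a b, f (e (tmul a b)) = g (e (tmul a b))) : f = g := by
  have : f ∘L toOp e = g ∘L toOp e := clm_ext h
  ext x
  simpa using congrArg (fun k => k (e.symm x)) this

theorem equiv_ext (e : HTensor A B ≃ₗᵢ[ℂ] C) {f g : C ≃ₗᵢ[ℂ] X}
    (h : ∀ a b, f (e (tmul a b)) = g (e (tmul a b))) : f = g := by
  have : toOp f = toOp g := clm_ext_equiv e h
  ext x
  exact congrArg (fun k => k x) this

theorem equiv_ext_tmul {f g : HTensor A B ≃ₗᵢ[ℂ] X}
    (h : ∀ a b, f (tmul a b) = g (tmul a b)) : f = g :=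
  equiv_ext (LinearIsometryEquiv.refl ℂ _) h

/-- The rearrangements `e` and `e'` let one factor of the test vectors stay a general tensor. This
is needed because a unitary does not send elementary tensors to elementary tensors. -/
theorem clm_ext_left (e : HTensor A B ≃ₗᵢ[ℂ] C) (e' : HTensor C D ≃ₗᵢ[ℂ] D') {f g : D' →L[ℂ] X}
    (h : ∀ a b d, f (e' (tmul (e (tmul a b)) d)) = g (e' (tmul (e (tmul a b)) d))) : f = g :=
  clm_ext_equiv e' fun c d => congrArg (fun k => k c) (clm_ext_equiv e
    (f := f ∘L toOp e' ∘L tmulRight _ d) (g := g ∘L toOp e' ∘L tmulRight _ d)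
    fun a b => h a b d)

theorem equiv_ext_left (e : HTensor A B ≃ₗᵢ[ℂ] C) (e' : HTensor C D ≃ₗᵢ[ℂ] D') {f g : D' ≃ₗᵢ[ℂ] X}
    (h : ∀ a b d, f (e' (tmul (e (tmul a b)) d)) = g (e' (tmul (e (tmul a b)) d))) : f = g := by
  have : toOp f = toOp g := clm_ext_left e e' h
  ext x
  exact congrArg (fun k => k x) this

theorem clm_ext₃ {f g : HTensor (HTensor A B) C →L[ℂ] X}
    (h : ∀ a b c, f (tmul (tmul a b) c) = g (tmul (tmul a b) c)) : f = g :=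
  clm_ext fun x c => congrArg (fun k => k x)
    (clm_ext (f := f ∘L tmulRight _ c) (g := g ∘L tmulRight _ c) fun a b => h a b c)

theorem equiv_ext₃ {f g : HTensor (HTensor A B) C ≃ₗᵢ[ℂ] X}
    (h : ∀ a b c, f (tmul (tmul a b) c) = g (tmul (tmul a b) c)) : f = g := by
  have : toOp f = toOp g := clm_ext₃ h
  ext x
  exact congrArg (fun k => k x) this

theorem assoc_symm_tmul (x : A) (y : B) (z : C) :
    (assoc A B C).symm (tmul x (tmul y z)) = tmul (tmul x y) z := by
  rw [← assoc_tmul, LinearIsometryEquiv.symm_apply_apply]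

theorem flip_symm : (flip A B).symm = flip B A := by
  apply equiv_ext_tmul
  intro a b
  rw [LinearIsometryEquiv.symm_apply_eq, flip_tmul, flip_tmul]

/-! ### Tensor products of operators -/

theorem map_id_id : map (ContinuousLinearMap.id ℂ A) (ContinuousLinearMap.id ℂ B) =
    ContinuousLinearMap.id ℂ (HTensor A B) :=
  clm_ext fun a b => by simp [map_tmul]

theorem map_comp_map (a : A →L[ℂ] A') (b : B →L[ℂ] B') (a' : A' →L[ℂ] A'') (b' : B' →L[ℂ] B'') :
    map a' b' ∘L map a b = map (a' ∘L a) (b' ∘L b) :=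
  clm_ext fun x y => by simp [map_tmul]

theorem map_zero_left (b : B →L[ℂ] B') : map (0 : A →L[ℂ] A') b = 0 :=
  clm_ext fun x y => by
    rw [map_tmul]
    exact map_zero (tmulRight A' (b y))

theorem map_add_left (a a' : A →L[ℂ] A') (b : B →L[ℂ] B') :
    map (a + a') b = map a b + map a' b :=
  clm_ext fun x y => by simp [map_tmul, add_tmul]

theorem map_smul_left (c : ℂ) (a : A →L[ℂ] A') (b : B →L[ℂ] B') :
    map (c • a) b = c • map a b :=
  clm_ext fun x y => by simp [map_tmul, smul_tmul]

theorem toOp_congr (f : A ≃ₗᵢ[ℂ] A') (g : B ≃ₗᵢ[ℂ] B') :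
    toOp (congr f g) = map (toOp f) (toOp g) :=
  clm_ext fun x y => by
    rw [map_tmul]
    exact congr_tmul f g x y

theorem toOp_apply (f : A ≃ₗᵢ[ℂ] A') (x : A) : toOp f x = f x := rfl

theorem toOp_injective {f g : A ≃ₗᵢ[ℂ] A'} (h : toOp f = toOp g) : f = g := by
  ext x
  exact congrArg (fun k => k x) h

theorem adjoint_map [CompleteSpace A] [CompleteSpace B] [CompleteSpace A'] [CompleteSpace B']
    (a : A →L[ℂ] A') (b : B →L[ℂ] B') :
    ContinuousLinearMap.adjoint (map a b) =
      map (ContinuousLinearMap.adjoint a) (ContinuousLinearMap.adjoint b) := by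
  refine clm_ext fun x y => ?_
  rw [map_tmul]
  refine ext_inner_right ℂ fun z => ?_
  rw [ContinuousLinearMap.adjoint_inner_left]
  have := clm_ext (f := innerSL ℂ (tmul x y) ∘L map a b)
    (g := innerSL ℂ (tmul (ContinuousLinearMap.adjoint a x) (ContinuousLinearMap.adjoint b y)))
    fun u v => by
      simp [map_tmul, inner_tmul, ContinuousLinearMap.adjoint_inner_left]
  exact congrArg (fun k => k z) this

theorem adjoint_toOp [CompleteSpace A] [CompleteSpace A'] (f : A ≃ₗᵢ[ℂ] A') :
    ContinuousLinearMap.adjoint (toOp f) = toOp f.symm := by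
  ext x
  refine ext_inner_right ℂ fun z => ?_
  rw [ContinuousLinearMap.adjoint_inner_left, toOp_apply, toOp_apply,
    ← LinearIsometryEquiv.inner_map_map f, LinearIsometryEquiv.apply_symm_apply]

/-! ### Leg numbering -/

theorem leg12_tmul (T : HTensor A B ≃ₗᵢ[ℂ] HTensor A' B') (p : HTensor A B) (c : C) :
    leg12 C T (tmul p c) = tmul (T p) c :=
  congr_tmul _ _ _ _

/-- Together with `leg12_tmul` and `leg13_swap`, this characterises leg numbering on vectors where
the two active legs carry an arbitrary tensor and the idle leg splits off. -/
theorem leg23_assoc_symm (T : HTensor B C ≃ₗᵢ[ℂ] HTensor B' C') (a : A) (q : HTensor B C) :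
    leg23 A T ((assoc A B C).symm (tmul a q)) = (assoc A B' C').symm (tmul a (T q)) := by
  simp [leg23, congr_tmul]

variable (A B C) in
/-- The unitary `(a ⊗ c) ⊗ b ↦ (a ⊗ b) ⊗ c`. -/
def swap : HTensor (HTensor A C) B ≃ₗᵢ[ℂ] HTensor (HTensor A B) C := leg23 A (flip C B)

theorem swap_tmul (a : A) (b : B) (c : C) :
    swap A B C (tmul (tmul a c) b) = tmul (tmul a b) c := by
  rw [swap, ← assoc_symm_tmul, leg23_assoc_symm, flip_tmul, assoc_symm_tmul]

theorem leg23_trans (T : HTensor B C ≃ₗᵢ[ℂ] HTensor B' C')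
    (T' : HTensor B' C' ≃ₗᵢ[ℂ] HTensor B'' C'') :
    leg23 A (T.trans T') = (leg23 A T).trans (leg23 A T') :=
  equiv_ext (assoc A B C).symm fun a q => by simp [leg23_assoc_symm]

theorem leg23_symm (T : HTensor B C ≃ₗᵢ[ℂ] HTensor B' C') :
    (leg23 A T).symm = leg23 A T.symm :=
  equiv_ext (assoc A B' C').symm fun a q => by
    rw [LinearIsometryEquiv.symm_apply_eq, leg23_assoc_symm, leg23_assoc_symm,
      LinearIsometryEquiv.apply_symm_apply]

theorem swap_symm : (swap A B C).symm = swap A C B := by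
  rw [swap, leg23_symm, flip_symm, swap]

theorem leg13_swap (T : HTensor A C ≃ₗᵢ[ℂ] HTensor A' C') (p : HTensor A C) (b : B) :
    leg13 B T (swap A B C (tmul p b)) = swap A' B C' (tmul (T p) b) := by
  have : leg23 A (flip B C) (swap A B C (tmul p b)) = tmul p b := by
    change swap A C B _ = _
    rw [← swap_symm, LinearIsometryEquiv.symm_apply_apply]
  simp only [leg13, LinearIsometryEquiv.trans_apply, this, leg12_tmul]
  rfl

theorem leg12_mul (T T' : HTensor A B ≃ₗᵢ[ℂ] HTensor A B) :
    leg12 C (T * T') = leg12 C T * leg12 C T' :=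
  equiv_ext_tmul fun p c => by simp [leg12_tmul]

theorem leg23_mul (T T' : HTensor B C ≃ₗᵢ[ℂ] HTensor B C) :
    leg23 A (T * T') = leg23 A T * leg23 A T' :=
  equiv_ext (assoc A B C).symm fun a q => by simp [leg23_assoc_symm]

theorem leg13_mul (T T' : HTensor A C ≃ₗᵢ[ℂ] HTensor A C) :
    leg13 B (T * T') = leg13 B T * leg13 B T' :=
  equiv_ext (swap A B C) fun p b => by simp [leg13_swap]

theorem leg12_one : leg12 C (1 : HTensor A B ≃ₗᵢ[ℂ] HTensor A B) = 1 :=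
  equiv_ext_tmul fun p c => by simp [leg12_tmul]

theorem leg23_one : leg23 A (1 : HTensor B C ≃ₗᵢ[ℂ] HTensor B C) = 1 :=
  equiv_ext (assoc A B C).symm fun a q => by simp [leg23_assoc_symm]

theorem leg13_one : leg13 B (1 : HTensor A C ≃ₗᵢ[ℂ] HTensor A C) = 1 :=
  equiv_ext (swap A B C) fun p b => by simp [leg13_swap]

theorem leg12_inv (T : HTensor A B ≃ₗᵢ[ℂ] HTensor A B) : leg12 C T⁻¹ = (leg12 C T)⁻¹ :=
  eq_inv_of_mul_eq_one_left (by rw [← leg12_mul, inv_mul_cancel, leg12_one])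

theorem leg23_inv (T : HTensor B C ≃ₗᵢ[ℂ] HTensor B C) : leg23 A T⁻¹ = (leg23 A T)⁻¹ :=
  eq_inv_of_mul_eq_one_left (by rw [← leg23_mul, inv_mul_cancel, leg23_one])

theorem leg13_inv (T : HTensor A C ≃ₗᵢ[ℂ] HTensor A C) : leg13 B T⁻¹ = (leg13 B T)⁻¹ :=
  eq_inv_of_mul_eq_one_left (by rw [← leg13_mul, inv_mul_cancel, leg13_one])

/-- A fixed nonzero vector in the idle leg can be cancelled. Uniqueness of braiding unitaries, and
with it the role of H ≠ 0, comes from here. -/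
theorem leg13_injective [Nontrivial B] {T T' : HTensor A C ≃ₗᵢ[ℂ] HTensor A' C'}
    (h : leg13 B T = leg13 B T') : T = T' := by
  obtain ⟨b, hb⟩ := exists_ne (0 : B)
  ext p
  have := congrArg (fun k => k (swap A B C (tmul p b))) h
  simp only [leg13_swap] at this
  exact tmul_right_cancel hb ((swap A' B C').injective this)

/-- Conjugating `T₁₂` by `(Z Σ)₂₃` gives `Z₂₃ T₁₃ Z₂₃⁻¹`. -/
theorem conjBy_leg23_flip_trans (Z : HTensor B C ≃ₗᵢ[ℂ] HTensor B C)
    (T : HTensor A C ≃ₗᵢ[ℂ] HTensor A C) :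
    conjBy (leg23 A ((flip C B).trans Z)) (leg12 B T) =
      leg23 A Z * leg13 B T * (leg23 A Z)⁻¹ := by
  rw [leg23_trans]
  ext x
  simp [conjBy, leg13, leg23_symm, flip_symm, LinearIsometryEquiv.inv_def]

end

end HTensor

/-! ### Leg numbering on four legs and commutation of disjoint legs. -/

namespace HTensor

noncomputable section

variable {A B C D : Type*}
  [NormedAddCommGroup A] [InnerProductSpace ℂ A]
  [NormedAddCommGroup B] [InnerProductSpace ℂ B]
  [NormedAddCommGroup C] [InnerProductSpace ℂ C]
  [NormedAddCommGroup D] [InnerProductSpace ℂ D]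

/-! ### Leg numbering on four legs -/

theorem conjBy_mul (Y : A ≃ₗᵢ[ℂ] B) (X X' : A ≃ₗᵢ[ℂ] A) :
    conjBy Y (X * X') = conjBy Y X * conjBy Y X' := by
  ext x; simp [conjBy]

theorem conjBy_one (Y : A ≃ₗᵢ[ℂ] B) : conjBy Y 1 = 1 := by
  ext x; simp [conjBy]

theorem conjBy_conjBy_symm (Y : A ≃ₗᵢ[ℂ] B) (X : B ≃ₗᵢ[ℂ] B) :
    conjBy Y (conjBy Y.symm X) = X := by
  ext x; simp [conjBy]

theorem conjBy_injective {Y : A ≃ₗᵢ[ℂ] B} {X X' : A ≃ₗᵢ[ℂ] A}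
    (h : conjBy Y X = conjBy Y X') : X = X' := by
  ext x
  simpa [conjBy] using congrArg (fun k => k (Y x)) h

variable (B) in
/-- Leg numbering: a unitary on `A ⊗ C ⊗ D` acting on the legs 1, 3, 4 of `A ⊗ B ⊗ C ⊗ D`. -/
def leg134 (Y : HTensor (HTensor A C) D ≃ₗᵢ[ℂ] HTensor (HTensor A C) D) :
    HTensor (HTensor (HTensor A B) C) D ≃ₗᵢ[ℂ] HTensor (HTensor (HTensor A B) C) D :=
  conjBy (assoc (HTensor A B) C D).symm (leg13 B (conjBy (assoc A C D) Y))

variable (A) in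
/-- Leg numbering: a unitary on `B ⊗ C ⊗ D` acting on the legs 2, 3, 4 of `A ⊗ B ⊗ C ⊗ D`. -/
def leg234 (Y : HTensor (HTensor B C) D ≃ₗᵢ[ℂ] HTensor (HTensor B C) D) :
    HTensor (HTensor (HTensor A B) C) D ≃ₗᵢ[ℂ] HTensor (HTensor (HTensor A B) C) D :=
  conjBy (assoc (HTensor A B) C D).symm (leg23 A (conjBy (assoc B C D) Y))

theorem leg134_mul (Y Y' : HTensor (HTensor A C) D ≃ₗᵢ[ℂ] HTensor (HTensor A C) D) :
    leg134 B (Y * Y') = leg134 B Y * leg134 B Y' := by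
  simp only [leg134, conjBy_mul, leg13_mul]

theorem leg234_mul (Y Y' : HTensor (HTensor B C) D ≃ₗᵢ[ℂ] HTensor (HTensor B C) D) :
    leg234 A (Y * Y') = leg234 A Y * leg234 A Y' := by
  simp only [leg234, conjBy_mul, leg23_mul]

theorem leg134_inv (Y : HTensor (HTensor A C) D ≃ₗᵢ[ℂ] HTensor (HTensor A C) D) :
    leg134 B Y⁻¹ = (leg134 B Y)⁻¹ :=
  eq_inv_of_mul_eq_one_left (by
    rw [← leg134_mul, inv_mul_cancel, leg134, conjBy_one, leg13_one, conjBy_one])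

theorem leg234_inv (Y : HTensor (HTensor B C) D ≃ₗᵢ[ℂ] HTensor (HTensor B C) D) :
    leg234 A Y⁻¹ = (leg234 A Y)⁻¹ :=
  eq_inv_of_mul_eq_one_left (by
    rw [← leg234_mul, inv_mul_cancel, leg234, conjBy_one, leg23_one, conjBy_one])

theorem leg134_injective [Nontrivial B]
    {Y Y' : HTensor (HTensor A C) D ≃ₗᵢ[ℂ] HTensor (HTensor A C) D}
    (h : leg134 B Y = leg134 B Y') : Y = Y' :=
  conjBy_injective (leg13_injective (conjBy_injective h))

/-- Inserting a vector `b` in the second leg: `(a ⊗ c) ⊗ d ↦ ((a ⊗ b) ⊗ c) ⊗ d`. -/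
def insertTwo (b : B) (z : HTensor (HTensor A C) D) : HTensor (HTensor (HTensor A B) C) D :=
  (assoc (HTensor A B) C D).symm (swap A B (HTensor C D) (tmul (assoc A C D z) b))

/-- Inserting a vector `a` in the first leg: `(b ⊗ c) ⊗ d ↦ ((a ⊗ b) ⊗ c) ⊗ d`. -/
def insertOne (a : A) (z : HTensor (HTensor B C) D) : HTensor (HTensor (HTensor A B) C) D :=
  (assoc (HTensor A B) C D).symm ((assoc A B (HTensor C D)).symm (tmul a (assoc B C D z)))

/-- Inserting an idle vector reduces identities for `leg134` to the three-leg formulas; `insertOne`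
plays the same role for `leg234`. -/
theorem leg134_insertTwo (Y : HTensor (HTensor A C) D ≃ₗᵢ[ℂ] HTensor (HTensor A C) D)
    (b : B) (z : HTensor (HTensor A C) D) :
    leg134 B Y (insertTwo b z) = insertTwo b (Y z) := by
  simp [leg134, conjBy, insertTwo, leg13_swap]

theorem leg234_insertOne (Y : HTensor (HTensor B C) D ≃ₗᵢ[ℂ] HTensor (HTensor B C) D)
    (a : A) (z : HTensor (HTensor B C) D) :
    leg234 A Y (insertOne a z) = insertOne a (Y z) := by
  simp [leg234, conjBy, insertOne, leg23_assoc_symm]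

theorem insertTwo_tmul (b : B) (p : HTensor A C) (d : D) :
    insertTwo b (tmul p d) = tmul (swap A B C (tmul p b)) d := by
  unfold insertTwo
  induction p using HTensor.induction_on with
  | closed => exact isClosed_eq (by fun_prop) (by fun_prop)
  | add x y hx hy => simp only [add_tmul, map_add, hx, hy]
  | tmul a c =>
    rw [assoc_tmul, swap_tmul, swap_tmul, assoc_symm_tmul]

theorem insertTwo_swap (b : B) (p : HTensor A D) (c : C) :
    insertTwo b (swap A C D (tmul p c)) =
      swap (HTensor A B) C D (tmul (swap A B D (tmul p b)) c) := by
  unfold insertTwo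
  induction p using HTensor.induction_on with
  | closed => exact isClosed_eq (by fun_prop) (by fun_prop)
  | add x y hx hy => simp only [add_tmul, map_add, hx, hy]
  | tmul a d =>
    simp only [assoc_tmul, swap_tmul, assoc_symm_tmul]

theorem insertTwo_assoc_symm (b : B) (a : A) (q : HTensor C D) :
    insertTwo b ((assoc A C D).symm (tmul a q)) =
      (assoc (HTensor A B) C D).symm (tmul (tmul a b) q) := by
  rw [insertTwo, LinearIsometryEquiv.apply_symm_apply, swap_tmul]

theorem insertOne_tmul (a : A) (p : HTensor B C) (d : D) :
    insertOne a (tmul p d) = tmul ((assoc A B C).symm (tmul a p)) d := by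
  unfold insertOne
  induction p using HTensor.induction_on with
  | closed => exact isClosed_eq (by fun_prop) (by fun_prop)
  | add x y hx hy => simp only [add_tmul, tmul_add, map_add, hx, hy]
  | tmul b c =>
    simp only [assoc_tmul, assoc_symm_tmul]

theorem insertOne_swap (a : A) (p : HTensor B D) (c : C) :
    insertOne a (swap B C D (tmul p c)) =
      swap (HTensor A B) C D (tmul ((assoc A B D).symm (tmul a p)) c) := by
  unfold insertOne
  induction p using HTensor.induction_on with
  | closed => exact isClosed_eq (by fun_prop) (by fun_prop)
  | add x y hx hy => simp only [add_tmul, tmul_add, map_add, hx, hy]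
  | tmul b c =>
    simp only [assoc_tmul, assoc_symm_tmul, swap_tmul]

theorem insertOne_assoc_symm (a : A) (b : B) (q : HTensor C D) :
    insertOne a ((assoc B C D).symm (tmul b q)) =
      (assoc (HTensor A B) C D).symm (tmul (tmul a b) q) := by
  unfold insertOne
  rw [LinearIsometryEquiv.apply_symm_apply, assoc_symm_tmul]

/-- This and the following identities bring every two-leg unitary on four legs to one normal form.
For instance T₁₄ is `leg13 C (leg13 B T)`, T₂₄ is `leg13 C (leg23 A T)` and T₃₄ is `leg23 (HTensor A
B) T`. -/
theorem leg13_leg12 (T : HTensor A B ≃ₗᵢ[ℂ] HTensor A B) :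
    leg13 C (leg12 D T) = leg12 D (leg12 C T) :=
  equiv_ext₃ fun p c d => by
    rw [← swap_tmul, leg13_swap, leg12_tmul, swap_tmul, swap_tmul, leg12_tmul, leg12_tmul]

theorem leg134_leg12 (T : HTensor A C ≃ₗᵢ[ℂ] HTensor A C) :
    leg134 B (leg12 D T) = leg12 D (leg13 B T) :=
  equiv_ext_left (swap A B C) (LinearIsometryEquiv.refl ℂ _) fun p b d => by
    rw [LinearIsometryEquiv.coe_refl, id_eq, ← insertTwo_tmul, leg134_insertTwo, leg12_tmul,
      insertTwo_tmul, insertTwo_tmul, leg12_tmul, leg13_swap]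

theorem leg134_leg13 (T : HTensor A D ≃ₗᵢ[ℂ] HTensor A D) :
    leg134 B (leg13 C T) = leg13 C (leg13 B T) :=
  equiv_ext_left (swap A B D) (swap (HTensor A B) C D) fun p b c => by
    rw [← insertTwo_swap, leg134_insertTwo, leg13_swap, insertTwo_swap, insertTwo_swap,
      leg13_swap, leg13_swap]

theorem leg134_leg23 (T : HTensor C D ≃ₗᵢ[ℂ] HTensor C D) :
    leg134 B (leg23 A T) = leg23 (HTensor A B) T :=
  equiv_ext_left (LinearIsometryEquiv.refl ℂ _) (assoc (HTensor A B) C D).symm fun a b q => by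
    rw [LinearIsometryEquiv.coe_refl, id_eq, leg23_assoc_symm, ← insertTwo_assoc_symm,
      ← insertTwo_assoc_symm, leg134_insertTwo, leg23_assoc_symm]

theorem leg234_leg12 (T : HTensor B C ≃ₗᵢ[ℂ] HTensor B C) :
    leg234 A (leg12 D T) = leg12 D (leg23 A T) :=
  equiv_ext_left (assoc A B C).symm (LinearIsometryEquiv.refl ℂ _) fun a p d => by
    rw [LinearIsometryEquiv.coe_refl, id_eq, ← insertOne_tmul, leg234_insertOne, leg12_tmul,
      insertOne_tmul, insertOne_tmul, leg12_tmul, leg23_assoc_symm]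

theorem leg234_leg13 (T : HTensor B D ≃ₗᵢ[ℂ] HTensor B D) :
    leg234 A (leg13 C T) = leg13 C (leg23 A T) :=
  equiv_ext_left (assoc A B D).symm (swap (HTensor A B) C D) fun a p c => by
    rw [← insertOne_swap, leg234_insertOne, leg13_swap, insertOne_swap, insertOne_swap,
      leg13_swap, leg23_assoc_symm]

theorem leg234_leg23 (T : HTensor C D ≃ₗᵢ[ℂ] HTensor C D) :
    leg234 A (leg23 B T) = leg23 (HTensor A B) T :=
  equiv_ext_left (LinearIsometryEquiv.refl ℂ _) (assoc (HTensor A B) C D).symm fun a b q => by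
    rw [LinearIsometryEquiv.coe_refl, id_eq, leg23_assoc_symm, ← insertOne_assoc_symm,
      ← insertOne_assoc_symm, leg234_insertOne, leg23_assoc_symm]

theorem leg12_leg12_assoc_symm (T : HTensor A B ≃ₗᵢ[ℂ] HTensor A B) (p : HTensor A B)
    (q : HTensor C D) : leg12 D (leg12 C T) ((assoc (HTensor A B) C D).symm (tmul p q)) =
      (assoc (HTensor A B) C D).symm (tmul (T p) q) := by
  induction q using HTensor.induction_on with
  | closed => exact isClosed_eq (by fun_prop) (by fun_prop)
  | add x y hx hy => simp only [tmul_add, map_add, hx, hy]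
  | tmul c d =>
    rw [assoc_symm_tmul, assoc_symm_tmul, leg12_tmul, leg12_tmul]

theorem commute_leg12_leg34 (T : HTensor A B ≃ₗᵢ[ℂ] HTensor A B)
    (T' : HTensor C D ≃ₗᵢ[ℂ] HTensor C D) :
    Commute (leg12 D (leg12 C T)) (leg23 (HTensor A B) T') :=
  equiv_ext (assoc (HTensor A B) C D).symm fun p q => by
    simp only [LinearIsometryEquiv.coe_mul, Function.comp_apply, leg12_leg12_assoc_symm, leg23_assoc_symm]

variable (A B C D) in
/-- The unitary `(a ⊗ c) ⊗ (b ⊗ d) ↦ ((a ⊗ b) ⊗ c) ⊗ d`. -/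
def shuffle13 : HTensor (HTensor A C) (HTensor B D) ≃ₗᵢ[ℂ] HTensor (HTensor (HTensor A B) C) D :=
  (assoc (HTensor A C) B D).symm.trans (leg12 D (swap A B C))

theorem shuffle13_tmul_right (p : HTensor A C) (b : B) (d : D) :
    shuffle13 A B C D (tmul p (tmul b d)) = tmul (swap A B C (tmul p b)) d := by
  rw [shuffle13, LinearIsometryEquiv.trans_apply, assoc_symm_tmul, leg12_tmul]

theorem shuffle13_tmul_left (a : A) (c : C) (q : HTensor B D) :
    shuffle13 A B C D (tmul (tmul a c) q) =
      swap (HTensor A B) C D (tmul ((assoc A B D).symm (tmul a q)) c) := by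
  induction q using HTensor.induction_on with
  | closed => exact isClosed_eq (by fun_prop) (by fun_prop)
  | add x y hx hy => simp only [add_tmul, tmul_add, map_add, hx, hy]
  | tmul b d =>
    rw [shuffle13_tmul_right, swap_tmul, assoc_symm_tmul, swap_tmul]

/-- After `shuffle13` regroups the legs as (A ⊗ C) ⊗ (B ⊗ D), the two unitaries become T ⊗ 1 and 1 ⊗
T'. -/
theorem commute_leg13_leg24 (T : HTensor A C ≃ₗᵢ[ℂ] HTensor A C)
    (T' : HTensor B D ≃ₗᵢ[ℂ] HTensor B D) :
    Commute (leg12 D (leg13 B T)) (leg13 C (leg23 A T')) := by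
  have h1 : ∀ (p : HTensor A C) (q : HTensor B D), leg12 D (leg13 B T)
      (shuffle13 A B C D (tmul p q)) = shuffle13 A B C D (tmul (T p) q) := by
    intro p q
    induction q using HTensor.induction_on with
    | closed => exact isClosed_eq (by fun_prop) (by fun_prop)
    | add x y hx hy => simp only [tmul_add, map_add, hx, hy]
    | tmul b d =>
      rw [shuffle13_tmul_right, shuffle13_tmul_right, leg12_tmul, leg13_swap]
  have h2 : ∀ (p : HTensor A C) (q : HTensor B D), leg13 C (leg23 A T')
      (shuffle13 A B C D (tmul p q)) = shuffle13 A B C D (tmul p (T' q)) := by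
    intro p q
    induction p using HTensor.induction_on with
    | closed => exact isClosed_eq (by fun_prop) (by fun_prop)
    | add x y hx hy => simp only [add_tmul, map_add, hx, hy]
    | tmul a c =>
      rw [shuffle13_tmul_left, shuffle13_tmul_left, leg13_swap, leg23_assoc_symm]
  exact equiv_ext (shuffle13 A B C D) fun p q => by
    simp only [LinearIsometryEquiv.coe_mul, Function.comp_apply, h1, h2]

variable (A B C D) in
/-- The unitary `(a ⊗ d) ⊗ (b ⊗ c) ↦ ((a ⊗ b) ⊗ c) ⊗ d`. -/
def shuffle14 : HTensor (HTensor A D) (HTensor B C) ≃ₗᵢ[ℂ] HTensor (HTensor (HTensor A B) C) D :=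
  ((assoc (HTensor A D) B C).symm.trans (leg12 C (swap A B D))).trans (swap (HTensor A B) C D)

theorem shuffle14_tmul_right (p : HTensor A D) (b : B) (c : C) :
    shuffle14 A B C D (tmul p (tmul b c)) =
      swap (HTensor A B) C D (tmul (swap A B D (tmul p b)) c) := by
  rw [shuffle14, LinearIsometryEquiv.trans_apply, LinearIsometryEquiv.trans_apply,
    assoc_symm_tmul, leg12_tmul]

theorem shuffle14_tmul_left (a : A) (d : D) (q : HTensor B C) :
    shuffle14 A B C D (tmul (tmul a d) q) = tmul ((assoc A B C).symm (tmul a q)) d := by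
  induction q using HTensor.induction_on with
  | closed => exact isClosed_eq (by fun_prop) (by fun_prop)
  | add x y hx hy => simp only [add_tmul, tmul_add, map_add, hx, hy]
  | tmul b c =>
    rw [shuffle14_tmul_right, swap_tmul, assoc_symm_tmul, swap_tmul]

theorem commute_leg14_leg23 (T : HTensor A D ≃ₗᵢ[ℂ] HTensor A D)
    (T' : HTensor B C ≃ₗᵢ[ℂ] HTensor B C) :
    Commute (leg13 C (leg13 B T)) (leg12 D (leg23 A T')) := by
  have h1 : ∀ (p : HTensor A D) (q : HTensor B C), leg13 C (leg13 B T)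
      (shuffle14 A B C D (tmul p q)) = shuffle14 A B C D (tmul (T p) q) := by
    intro p q
    induction q using HTensor.induction_on with
    | closed => exact isClosed_eq (by fun_prop) (by fun_prop)
    | add x y hx hy => simp only [tmul_add, map_add, hx, hy]
    | tmul b d =>
      rw [shuffle14_tmul_right, shuffle14_tmul_right, leg13_swap, leg13_swap]
  have h2 : ∀ (p : HTensor A D) (q : HTensor B C), leg12 D (leg23 A T')
      (shuffle14 A B C D (tmul p q)) = shuffle14 A B C D (tmul p (T' q)) := by
    intro p q
    induction p using HTensor.induction_on with
    | closed => exact isClosed_eq (by fun_prop) (by fun_prop)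
    | add x y hx hy => simp only [add_tmul, map_add, hx, hy]
    | tmul a c =>
      rw [shuffle14_tmul_left, shuffle14_tmul_left, leg12_tmul, leg23_assoc_symm]
  exact equiv_ext (shuffle14 A B C D) fun p q => by
    simp only [LinearIsometryEquiv.coe_mul, Function.comp_apply, h1, h2]

end

end HTensor

/-! ### Calculus of operators that intertwine unitaries. -/

namespace HTensor

noncomputable section

variable {A B C A' B' C' : Type*}
  [NormedAddCommGroup A] [InnerProductSpace ℂ A]
  [NormedAddCommGroup B] [InnerProductSpace ℂ B]
  [NormedAddCommGroup C] [InnerProductSpace ℂ C]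
  [NormedAddCommGroup A'] [InnerProductSpace ℂ A']
  [NormedAddCommGroup B'] [InnerProductSpace ℂ B']
  [NormedAddCommGroup C'] [InnerProductSpace ℂ C']

/-! ### Operators that intertwine unitaries -/

/-- The operator `f` intertwines the unitaries `X` and `Y`. -/
def Intertwines (f : A →L[ℂ] B) (X : A ≃ₗᵢ[ℂ] A) (Y : B ≃ₗᵢ[ℂ] B) : Prop :=
  f ∘L toOp X = toOp Y ∘L f

theorem Intertwines.apply {f : A →L[ℂ] B} {X : A ≃ₗᵢ[ℂ] A} {Y : B ≃ₗᵢ[ℂ] B}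
    (h : Intertwines f X Y) (x : A) : f (X x) = Y (f x) :=
  congrArg (fun k => k x) h

theorem intertwines_one (f : A →L[ℂ] B) : Intertwines f 1 1 := rfl

theorem Intertwines.mul {f : A →L[ℂ] B} {X X' : A ≃ₗᵢ[ℂ] A} {Y Y' : B ≃ₗᵢ[ℂ] B}
    (h : Intertwines f X Y) (h' : Intertwines f X' Y') : Intertwines f (X * X') (Y * Y') := by
  ext x
  simp [toOp_apply, h.apply, h'.apply]

theorem Intertwines.inv {f : A →L[ℂ] B} {X : A ≃ₗᵢ[ℂ] A} {Y : B ≃ₗᵢ[ℂ] B}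
    (h : Intertwines f X Y) : Intertwines f X⁻¹ Y⁻¹ := by
  ext x
  simp only [ContinuousLinearMap.comp_apply, toOp_apply, LinearIsometryEquiv.inv_def]
  rw [LinearIsometryEquiv.eq_symm_apply, ← h.apply, LinearIsometryEquiv.apply_symm_apply]

theorem Intertwines.comp {f : A →L[ℂ] B} {g : B →L[ℂ] C} {X : A ≃ₗᵢ[ℂ] A} {Y : B ≃ₗᵢ[ℂ] B}
    {Z : C ≃ₗᵢ[ℂ] C} (hf : Intertwines f X Y) (hg : Intertwines g Y Z) :
    Intertwines (g ∘L f) X Z := by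
  ext x
  simp [toOp_apply, hf.apply, hg.apply]

theorem Intertwines.adjoint [CompleteSpace A] [CompleteSpace B] {f : A →L[ℂ] B}
    {X : A ≃ₗᵢ[ℂ] A} {Y : B ≃ₗᵢ[ℂ] B} (h : Intertwines f X Y) :
    Intertwines (ContinuousLinearMap.adjoint f) Y X := by
  -- The adjoint of a unitary is its inverse, so the relation for the inverses is the one to take
  -- adjoints of.
  have := congrArg ContinuousLinearMap.adjoint h.inv
  rw [ContinuousLinearMap.adjoint_comp, ContinuousLinearMap.adjoint_comp, adjoint_toOp,
    adjoint_toOp] at this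
  exact this.symm

theorem intertwines_toOp_iff {X Y f : A ≃ₗᵢ[ℂ] A} :
    Intertwines (toOp f) X Y ↔ f * X = Y * f :=
  ⟨fun h => toOp_injective h, fun h => congrArg toOp h⟩

/-- If `X₁ X₂` and `X₂` are intertwined, then so is `X₁`. -/
theorem Intertwines.of_mul_right {f : A →L[ℂ] B} {X X' : A ≃ₗᵢ[ℂ] A} {Y Y' : B ≃ₗᵢ[ℂ] B}
    (h : Intertwines f (X * X') (Y * Y')) (h' : Intertwines f X' Y') : Intertwines f X Y := by
  simpa using h.mul h'.inv

/-- If `X₁ X₂` and `X₁` are intertwined, then so is `X₂`. -/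
theorem Intertwines.of_mul_left {f : A →L[ℂ] B} {X X' : A ≃ₗᵢ[ℂ] A} {Y Y' : B ≃ₗᵢ[ℂ] B}
    (h : Intertwines f (X * X') (Y * Y')) (h' : Intertwines f X Y) : Intertwines f X' Y' := by
  simpa using h'.inv.mul h

theorem map_swap (a : A →L[ℂ] A') (b : B →L[ℂ] B') (c : C →L[ℂ] C') (p : HTensor A C) (y : B) :
    map (map a b) c (swap A B C (tmul p y)) = swap A' B' C' (tmul (map a c p) (b y)) := by
  induction p using HTensor.induction_on with
  | closed => exact isClosed_eq (by fun_prop) (by fun_prop)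
  | add x y hx hy => simp only [add_tmul, map_add, hx, hy]
  | tmul x z => simp only [swap_tmul, map_tmul]

theorem map_assoc_symm (a : A →L[ℂ] A') (b : B →L[ℂ] B') (c : C →L[ℂ] C') (x : A)
    (q : HTensor B C) : map (map a b) c ((assoc A B C).symm (tmul x q)) =
      (assoc A' B' C').symm (tmul (a x) (map b c q)) := by
  induction q using HTensor.induction_on with
  | closed => exact isClosed_eq (by fun_prop) (by fun_prop)
  | add x y hx hy => simp only [tmul_add, map_add, hx, hy]
  | tmul y z => simp only [assoc_symm_tmul, map_tmul]

theorem Intertwines.leg12 {f : HTensor A B →L[ℂ] HTensor A' B'}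
    {X : HTensor A B ≃ₗᵢ[ℂ] HTensor A B} {Y : HTensor A' B' ≃ₗᵢ[ℂ] HTensor A' B'}
    (h : Intertwines f X Y) (c : C →L[ℂ] C') :
    Intertwines (map f c) (leg12 C X) (leg12 C' Y) :=
  clm_ext fun p z => by
    simp only [ContinuousLinearMap.comp_apply, toOp_apply, leg12_tmul, map_tmul, h.apply]

theorem Intertwines.leg13 {a : A →L[ℂ] A'} {c : C →L[ℂ] C'}
    {X : HTensor A C ≃ₗᵢ[ℂ] HTensor A C} {Y : HTensor A' C' ≃ₗᵢ[ℂ] HTensor A' C'}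
    (h : Intertwines (map a c) X Y) (b : B →L[ℂ] B') :
    Intertwines (map (map a b) c) (leg13 B X) (leg13 B' Y) :=
  clm_ext_equiv (swap A B C) fun p z => by
    simp only [ContinuousLinearMap.comp_apply, toOp_apply, leg13_swap, map_swap, h.apply]

theorem Intertwines.leg23 {b : B →L[ℂ] B'} {c : C →L[ℂ] C'}
    {X : HTensor B C ≃ₗᵢ[ℂ] HTensor B C} {Y : HTensor B' C' ≃ₗᵢ[ℂ] HTensor B' C'}
    (h : Intertwines (map b c) X Y) (a : A →L[ℂ] A') :
    Intertwines (map (map a b) c) (leg23 A X) (leg23 A' Y) :=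
  clm_ext_equiv (assoc A B C).symm fun x q => by
    simp only [ContinuousLinearMap.comp_apply, toOp_apply, leg23_assoc_symm, map_assoc_symm,
      h.apply]

theorem Intertwines.of_leg13 [Nontrivial B] {a : A →L[ℂ] A'} {c : C →L[ℂ] C'}
    {X : HTensor A C ≃ₗᵢ[ℂ] HTensor A C} {Y : HTensor A' C' ≃ₗᵢ[ℂ] HTensor A' C'}
    (h : Intertwines (map (map a (ContinuousLinearMap.id ℂ B)) c)
      (HTensor.leg13 B X) (HTensor.leg13 B Y)) : Intertwines (map a c) X Y := by
  obtain ⟨b, hb⟩ := exists_ne (0 : B)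
  ext p
  have := h.apply (swap A B C (tmul p b))
  rw [leg13_swap, map_swap, map_swap, leg13_swap] at this
  exact tmul_right_cancel hb ((swap A' B C').injective this)

theorem Intertwines.of_leg23 [Nontrivial A] {b : B →L[ℂ] B'} {c : C →L[ℂ] C'}
    {X : HTensor B C ≃ₗᵢ[ℂ] HTensor B C} {Y : HTensor B' C' ≃ₗᵢ[ℂ] HTensor B' C'}
    (h : Intertwines (map (map (ContinuousLinearMap.id ℂ A) b) c)
      (HTensor.leg23 A X) (HTensor.leg23 A Y)) : Intertwines (map b c) X Y := by
  obtain ⟨a, ha⟩ := exists_ne (0 : A)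
  ext q
  have := h.apply ((assoc A B C).symm (tmul a q))
  rw [leg23_assoc_symm, map_assoc_symm, map_assoc_symm, leg23_assoc_symm] at this
  exact tmul_left_cancel ha ((assoc A B' C').symm.injective this)

theorem intertwines_id (X : A ≃ₗᵢ[ℂ] A) : Intertwines (ContinuousLinearMap.id ℂ A) X X := rfl

theorem intertwines_map_id_id (X : HTensor A B ≃ₗᵢ[ℂ] HTensor A B) :
    Intertwines (map (ContinuousLinearMap.id ℂ A) (ContinuousLinearMap.id ℂ B)) X X := by
  rw [map_id_id]
  exact intertwines_id X

end

end HTensor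

/-! ### The braiding unitary: naturality, hexagon, Yang–Baxter. -/

section Braiding

variable {H L K K₁ K₂ : Type*}
  [NormedAddCommGroup H] [InnerProductSpace ℂ H]
  [NormedAddCommGroup L] [InnerProductSpace ℂ L]
  [NormedAddCommGroup K] [InnerProductSpace ℂ K]
  [NormedAddCommGroup K₁] [InnerProductSpace ℂ K₁]
  [NormedAddCommGroup K₂] [InnerProductSpace ℂ K₂]
  {W : HTensor H H ≃ₗᵢ[ℂ] HTensor H H}
  {U : HTensor L H ≃ₗᵢ[ℂ] HTensor L H}
  {V : HTensor H L ≃ₗᵢ[ℂ] HTensor H L}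
  {F : HTensor L L ≃ₗᵢ[ℂ] HTensor L L}
  {S : HTensor K H ≃ₗᵢ[ℂ] HTensor K H} {Z : HTensor K L ≃ₗᵢ[ℂ] HTensor K L}
  {S₁ : HTensor K₁ H ≃ₗᵢ[ℂ] HTensor K₁ H} {Z₁ : HTensor K₁ L ≃ₗᵢ[ℂ] HTensor K₁ L}
  {S₂ : HTensor K₂ H ≃ₗᵢ[ℂ] HTensor K₂ H} {Z₂ : HTensor K₂ L ≃ₗᵢ[ℂ] HTensor K₂ L}

/-- The equation for the braiding unitary in the form `V₂₃ S₁₂ = S₁₂ Z₁₃⁻¹ V₂₃`. -/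
theorem isBraidingUnitary_iff :
    IsBraidingUnitary V S Z ↔
      leg23 K V * leg12 L S = leg12 L S * leg13 H Z⁻¹ * leg23 K V := by
  rw [IsBraidingUnitary, leg13_inv]
  generalize leg13 H Z = z, leg23 K V = v, leg12 L S = s
  constructor
  · rintro rfl
    group
  · intro h
    have hz : z⁻¹ = s⁻¹ * (v * s) * v⁻¹ := by rw [h]; group
    rw [← inv_inv z, hz]
    group

theorem isBraidingUnitary_braidingUnitary (h : HasBraiding V S) :
    IsBraidingUnitary V S (braidingUnitary V S) := by
  rw [braidingUnitary, dif_pos h]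
  exact h.choose_spec

theorem IsBraidingUnitary.unique [Nontrivial H] {Z' : HTensor K L ≃ₗᵢ[ℂ] HTensor K L}
    (h : IsBraidingUnitary V S Z) (h' : IsBraidingUnitary V S Z') : Z = Z' :=
  leg13_injective (Eq.trans h (Eq.symm h'))

theorem IsBraidingUnitary.braidingUnitary_eq [Nontrivial H] (h : IsBraidingUnitary V S Z) :
    braidingUnitary V S = Z :=
  (isBraidingUnitary_braidingUnitary ⟨Z, h⟩).unique h

theorem isBraidingUnitary_one :
    IsBraidingUnitary V (1 : HTensor K H ≃ₗᵢ[ℂ] HTensor K H) 1 := by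
  rw [isBraidingUnitary_iff, inv_one, leg12_one, leg13_one]
  simp

/-- For the left regular representation, the braiding unitary is `V⁻¹`. -/
theorem IsLeftRep.isBraidingUnitary (h : IsLeftRep W V) : IsBraidingUnitary V W V⁻¹ := by
  rw [isBraidingUnitary_iff, inv_inv]
  exact h

/-- Braiding unitaries are natural for intertwiners. -/
theorem IsBraidingUnitary.intertwines [Nontrivial H] {a : K₁ →L[ℂ] K₂}
    (h₁ : IsBraidingUnitary V S₁ Z₁) (h₂ : IsBraidingUnitary V S₂ Z₂)
    (ha : Intertwines (HTensor.map a (ContinuousLinearMap.id ℂ H)) S₁ S₂) :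
    Intertwines (HTensor.map a (ContinuousLinearMap.id ℂ L)) Z₁ Z₂ := by
  -- After an idle H leg is added, `Z` becomes a word in V and S, and both of these are intertwined.
  refine Intertwines.of_leg13 (B := H) ?_
  rw [h₁, h₂]
  have hV := (intertwines_map_id_id V).leg23 a
  have hS := ha.leg12 (ContinuousLinearMap.id ℂ L)
  exact ((hV.mul hS.inv).mul hV.inv).mul hS

/-- The braiding unitary of `(S₁)₁₃ (S₂)₂₃` is `(Z₂)₂₃ (Z₁)₁₃`. -/
theorem IsBraidingUnitary.tensor (h₁ : IsBraidingUnitary V S₁ Z₁)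
    (h₂ : IsBraidingUnitary V S₂ Z₂) :
    IsBraidingUnitary V (leg13 K₂ S₁ * leg23 K₁ S₂) (leg23 K₁ Z₂ * leg13 K₂ Z₁) := by
  rw [isBraidingUnitary_iff] at *
  -- On K₁ ⊗ K₂ ⊗ H ⊗ L, V₃₄ is pushed past (S₁)₁₃ and then past (S₂)₂₃. The only reordering needed
  -- is that of (Z₁⁻¹)₁₄ and (S₂)₂₃, which act on disjoint legs.
  have e₁ := congrArg (leg134 K₂) h₁
  have e₂ := congrArg (leg234 K₁) h₂
  simp only [leg134_mul, leg134_leg12, leg134_leg13, leg134_leg23] at e₁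
  simp only [leg234_mul, leg234_leg12, leg234_leg13, leg234_leg23] at e₂
  have c := (commute_leg14_leg23 (C := H) (D := L) Z₁⁻¹ S₂).eq
  simp only [mul_inv_rev, leg12_mul, leg13_mul, ← leg13_inv, ← leg23_inv]
  grind

/-- The braiding unitary of `(S₂)₂₃ (S₁)₁₃` is `(Z₁)₁₃ (Z₂)₂₃`. -/
theorem IsBraidingUnitary.tensor_swap (h₁ : IsBraidingUnitary V S₁ Z₁)
    (h₂ : IsBraidingUnitary V S₂ Z₂) :
    IsBraidingUnitary V (leg23 K₁ S₂ * leg13 K₂ S₁) (leg13 K₂ Z₁ * leg23 K₁ Z₂) := by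
  rw [isBraidingUnitary_iff] at *
  have e₁ := congrArg (leg134 K₂) h₁
  have e₂ := congrArg (leg234 K₁) h₂
  simp only [leg134_mul, leg134_leg12, leg134_leg13, leg134_leg23] at e₁
  simp only [leg234_mul, leg234_leg12, leg234_leg13, leg234_leg23] at e₂
  have c := (commute_leg13_leg24 (C := H) (D := L) S₁ Z₂⁻¹).eq
  simp only [mul_inv_rev, leg12_mul, leg13_mul, ← leg13_inv, ← leg23_inv]
  generalize leg12 L (leg13 K₂ S₁) = s1, leg12 L (leg23 K₁ S₂) = s2,
    leg13 H (leg13 K₂ Z₁⁻¹) = z1, leg13 H (leg23 K₁ Z₂⁻¹) = z2,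
    leg23 (HTensor K₁ K₂) V = v at *
  calc v * (s2 * s1) = (v * s2) * s1 := by simp only [mul_assoc]
    _ = s2 * z2 * (v * s1) := by rw [e₂]; simp only [mul_assoc]
    _ = s2 * (z2 * s1) * z1 * v := by rw [e₁]; simp only [mul_assoc]
    _ = s2 * s1 * (z2 * z1) * v := by rw [← c]; simp only [mul_assoc]

/-- The tensor product of right representations is a right representation. -/
theorem IsRightRep.tensor (h₁ : IsRightRep W S₁) (h₂ : IsRightRep W S₂) :
    IsRightRep W (leg13 K₂ S₁ * leg23 K₁ S₂) := by
  have e₁ := congrArg (leg134 K₂) h₁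
  have e₂ := congrArg (leg234 K₁) h₂
  simp only [leg134_mul, leg134_leg12, leg134_leg13, leg134_leg23] at e₁
  simp only [leg234_mul, leg234_leg12, leg234_leg13, leg234_leg23] at e₂
  have c := (commute_leg14_leg23 (C := H) (D := H) S₁ S₂).eq
  simp only [IsRightRep, leg12_mul, leg13_mul]
  grind

/-- The braiding operator intertwines right representations: `S₁₃ U₂₃ Z₁₂ = Z₁₂ U₂₃ S₁₃`. -/
theorem IsBraidingUnitary.equivariant [Nontrivial H] (hS : IsRightRep W S)
    (hZ : IsBraidingUnitary V S Z)
    (hYD : leg12 H V * leg13 L W * leg23 H U = leg23 H U * leg13 L W * leg12 H V) :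
    leg13 L S * leg23 K U * leg12 H Z = leg12 H Z * (leg23 K U * leg13 L S) := by
  suffices h : leg12 H Z⁻¹ * (leg13 L S * leg23 K U) = leg23 K U * leg13 L S * leg12 H Z⁻¹ by
    rw [leg12_inv, inv_mul_eq_iff_eq_mul] at h
    rw [h]; group
  -- An auxiliary copy of H becomes the second leg, so that the equation for `Z`, which lives on K ⊗
  -- H ⊗ L, can be applied.
  refine leg134_injective (B := H) ?_
  rw [isBraidingUnitary_iff] at hZ
  have e₁ := congrArg (leg12 H) hZ
  have e₂ := congrArg (leg13 L) hS
  have e₃ := congrArg (leg234 K) hYD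
  simp only [leg12_mul] at e₁
  simp only [leg13_mul, leg13_leg12] at e₂
  simp only [leg234_mul, leg234_leg12, leg234_leg13, leg234_leg23] at e₃
  simp only [leg134_mul, leg134_leg12, leg134_leg13, leg134_leg23]
  have c₁ := (commute_leg12_leg34 S U).eq
  have c₂ := (commute_leg14_leg23 S V).eq
  have c₃ := (commute_leg13_leg24 Z⁻¹ W).eq
  -- Flanked by S₁₂ on the left and W₂₄ V₂₃ on the right, the two sides become V₂₃ W₂₄ U₃₄ S₁₂ and
  -- U₃₄ W₂₄ V₂₃ S₁₂ once S₁₂ is pulled out to the right. These agree by the Yetter–Drinfeld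
  -- condition.
  refine mul_left_cancel (a := leg12 H (leg12 L S)) (mul_right_cancel
    (b := leg13 L (leg23 K W) * leg12 H (leg23 K V)) ?_)
  generalize leg12 H (leg12 L S) = s12, leg13 L (leg23 K W) = w, leg12 H (leg23 K V) = v,
    leg12 H (leg13 H Z⁻¹) = z, leg13 L (leg13 H S) = s14, leg23 (HTensor K H) U = u at *
  calc s12 * (z * (s14 * u)) * (w * v)
      = s12 * z * s14 * (u * w * v) := by simp only [mul_assoc]
    _ = s12 * z * (s14 * v) * w * u := by rw [← e₃]; simp only [mul_assoc]
    _ = (s12 * z * v) * s14 * w * u := by rw [c₂]; simp only [mul_assoc]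
    _ = v * (s12 * s14 * w) * u := by rw [← e₁]; simp only [mul_assoc]
    _ = v * w * (s12 * u) := by rw [← e₂]; simp only [mul_assoc]
    _ = (v * w * u) * s12 := by rw [c₁]; simp only [mul_assoc]
    _ = u * w * (v * s12) := by rw [e₃]; simp only [mul_assoc]
    _ = u * (w * s12) * z * v := by rw [e₁]; simp only [mul_assoc]
    _ = (u * s12) * s14 * (w * z) * v := by rw [e₂]; simp only [mul_assoc]
    _ = s12 * (u * s14 * z) * (w * v) := by rw [← c₁, ← c₃]; simp only [mul_assoc]

/-- Naturality of the braiding for `F`: `Z₁₂ Z₁₃` commutes with `F₂₃`. -/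
theorem IsBraidingUnitary.commute_leg23 [Nontrivial H] (hZ : IsBraidingUnitary V S Z)
    (hF : leg13 L V * leg12 L V * leg23 H F = leg23 H F * (leg13 L V * leg12 L V)) :
    leg23 K F * (leg12 L Z * leg13 L Z) = leg12 L Z * leg13 L Z * leg23 K F := by
  suffices h : leg13 L Z⁻¹ * leg12 L Z⁻¹ * leg23 K F =
      leg23 K F * (leg13 L Z⁻¹ * leg12 L Z⁻¹) by
    have h' : Commute (leg12 L Z * leg13 L Z)⁻¹ (leg23 K F) := by
      rw [mul_inv_rev, ← leg12_inv, ← leg13_inv]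
      exact h
    exact (Commute.inv_left_iff.mp h').eq.symm
  refine leg134_injective (B := H) ?_
  rw [isBraidingUnitary_iff] at hZ
  have e₁ := congrArg (leg12 L) hZ
  have e₂ := congrArg (leg13 L) hZ
  have e₃ := congrArg (leg234 K) hF
  simp only [leg12_mul] at e₁
  simp only [leg13_mul, leg13_leg12] at e₂
  simp only [leg234_mul, leg234_leg12, leg234_leg13, leg234_leg23] at e₃
  simp only [leg134_mul, leg134_leg12, leg134_leg13, leg134_leg23]
  have c₁ := (commute_leg12_leg34 S F).eq
  have c₂ := (commute_leg13_leg24 Z⁻¹ V).eq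
  -- Two applications of the equation for `Z` give S₁₂ Z₁₄⁻¹ Z₁₃⁻¹ V₂₄ V₂₃ = V₂₄ V₂₃ S₁₂. As F₃₄
  -- commutes with V₂₄ V₂₃ and with S₁₂, it commutes with Z₁₄⁻¹ Z₁₃⁻¹.
  refine mul_left_cancel (a := leg12 L (leg12 L S)) (mul_right_cancel
    (b := leg13 L (leg23 K V) * leg12 L (leg23 K V)) ?_)
  generalize leg12 L (leg12 L S) = s, leg13 L (leg23 K V) = v4, leg12 L (leg23 K V) = v3,
    leg12 L (leg13 H Z⁻¹) = z3, leg13 L (leg13 H Z⁻¹) = z4, leg23 (HTensor K H) F = f at *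
  have e : s * z4 * z3 * v4 * v3 = v4 * v3 * s :=
    calc s * z4 * z3 * v4 * v3 = s * z4 * (z3 * v4) * v3 := by simp only [mul_assoc]
      _ = (s * z4 * v4) * z3 * v3 := by rw [c₂]; simp only [mul_assoc]
      _ = v4 * (s * z3 * v3) := by rw [← e₂]; simp only [mul_assoc]
      _ = v4 * v3 * s := by rw [← e₁]; simp only [mul_assoc]
  calc s * (z4 * z3 * f) * (v4 * v3) = s * z4 * z3 * (f * (v4 * v3)) := by simp only [mul_assoc]
    _ = (s * z4 * z3 * v4 * v3) * f := by rw [← e₃]; simp only [mul_assoc]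
    _ = v4 * v3 * (s * f) := by rw [e]; simp only [mul_assoc]
    _ = (v4 * v3 * f) * s := by rw [c₁]; simp only [mul_assoc]
    _ = f * (v4 * v3 * s) := by rw [e₃]; simp only [mul_assoc]
    _ = (f * s) * z4 * z3 * v4 * v3 := by rw [← e]; simp only [mul_assoc]
    _ = s * (f * (z4 * z3)) * (v4 * v3) := by rw [← c₁]; simp only [mul_assoc]

/-- The Yang–Baxter equation for the braiding unitaries. -/
theorem IsBraidingUnitary.yangBaxter [Nontrivial H] {ZU : HTensor L L ≃ₗᵢ[ℂ] HTensor L L}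
    (hS : IsRightRep W S) (hZ : IsBraidingUnitary V S Z) (hU : IsBraidingUnitary V U ZU)
    (hYD : leg12 H V * leg13 L W * leg23 H U = leg23 H U * leg13 L W * leg12 H V) :
    leg12 L Z * (leg13 L Z * leg23 K ZU) = leg23 K ZU * leg13 L Z * leg12 L Z := by
  -- By `equivariant`, `Z` intertwines U₂₃ S₁₃ with S₁₃ U₂₃. The braiding unitaries of these two
  -- products are Z₁₃ (ZU)₂₃ and (ZU)₂₃ Z₁₃.
  have h := (hZ.tensor_swap hU).intertwines (hZ.tensor hU) (a := toOp Z) (by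
    rw [← show toOp (LinearIsometryEquiv.refl ℂ H) = ContinuousLinearMap.id ℂ H from rfl,
      ← toOp_congr]
    exact intertwines_toOp_iff.mpr (hZ.equivariant hS hYD).symm)
  rw [← show toOp (LinearIsometryEquiv.refl ℂ L) = ContinuousLinearMap.id ℂ L from rfl,
    ← toOp_congr] at h
  exact intertwines_toOp_iff.mp h

/-- Naturality of the braiding for a unitary `T` on `K ⊗ L` that commutes with `S₁₃ U₂₃`. -/
theorem IsBraidingUnitary.commute_leg12 [Nontrivial H] {ZU : HTensor L L ≃ₗᵢ[ℂ] HTensor L L}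
    {T : HTensor K L ≃ₗᵢ[ℂ] HTensor K L}
    (hZ : IsBraidingUnitary V S Z) (hU : IsBraidingUnitary V U ZU)
    (hT : leg13 L S * leg23 K U * leg12 H T = leg12 H T * (leg13 L S * leg23 K U)) :
    leg12 L T * (leg23 K ZU * leg13 L Z) = leg23 K ZU * leg13 L Z * leg12 L T := by
  have h := (hZ.tensor hU).intertwines (hZ.tensor hU) (a := toOp T) (by
    rw [← show toOp (LinearIsometryEquiv.refl ℂ H) = ContinuousLinearMap.id ℂ H from rfl,
      ← toOp_congr]
    exact intertwines_toOp_iff.mpr hT.symm)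
  rw [← show toOp (LinearIsometryEquiv.refl ℂ L) = ContinuousLinearMap.id ℂ L from rfl,
    ← toOp_congr] at h
  exact intertwines_toOp_iff.mp h

end Braiding

/-! ### Tensor products of representations are representations. -/

namespace BraidedMultiplicativeUnitary

noncomputable section

variable {H L : Type u}
  [NormedAddCommGroup H] [InnerProductSpace ℂ H]
  [NormedAddCommGroup L] [InnerProductSpace ℂ L]
  {B : BraidedMultiplicativeUnitary H L}
  {K K₁ K₂ K₃ : Type u}
  [NormedAddCommGroup K] [InnerProductSpace ℂ K]
  [NormedAddCommGroup K₁] [InnerProductSpace ℂ K₁]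
  [NormedAddCommGroup K₂] [InnerProductSpace ℂ K₂]
  [NormedAddCommGroup K₃] [InnerProductSpace ℂ K₃]

theorem tensorRep_S (x₁ : B.PreRep K₁) (x₂ : B.PreRep K₂) :
    (B.tensorRep x₁ x₂).S = leg13 K₂ x₁.S * leg23 K₁ x₂.S := rfl

theorem tensorRep_T (x₁ : B.PreRep K₁) (x₂ : B.PreRep K₂) :
    (B.tensorRep x₁ x₂).T = leg23 K₁ (braidingUnitary B.V x₂.S) * leg13 K₂ x₁.T *
      (leg23 K₁ (braidingUnitary B.V x₂.S))⁻¹ * leg23 K₁ x₂.T :=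
  congrArg (· * leg23 K₁ x₂.T) (conjBy_leg23_flip_trans _ _)

theorem IsRep.isBraidingUnitary {x : B.PreRep K} (hx : B.IsRep x) :
    IsBraidingUnitary B.V x.S (braidingUnitary B.V x.S) :=
  isBraidingUnitary_braidingUnitary hx.hasBraiding

theorem isBraidingUnitary_U : IsBraidingUnitary B.V B.U (braidingUnitary B.V B.U) :=
  isBraidingUnitary_braidingUnitary B.hasBraiding

/-- The braided representation condition in terms of the unitary `Z` with `braiding = Z Σ`. -/
theorem IsRep.leg23_mul_leg12 {x : B.PreRep K} (hx : B.IsRep x) :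
    leg23 K B.F * leg12 L x.T = leg12 L x.T * (leg23 K (braidingUnitary B.V B.U) *
      leg13 L x.T * (leg23 K (braidingUnitary B.V B.U))⁻¹) * leg23 K B.F := by
  rw [hx.braidedRep, braiding, conjBy_leg23_flip_trans]

/-- Right representations of `W` with a braiding, with the trivial unitary on `K ⊗ L`. -/
theorem isRep_of_T_eq_one {x : B.PreRep K} (hS : IsRightRep B.W x.S) (hV : HasBraiding B.V x.S)
    (hT : x.T = 1) : B.IsRep x where
  rightRep := hS
  hasBraiding := hV
  equivariant := by rw [hT, leg12_one, mul_one, one_mul]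
  braidedRep := by
    rw [hT, braiding, conjBy_leg23_flip_trans, leg12_one, leg13_one]
    group

theorem isRep_triv : B.IsRep (⟨1, 1⟩ : B.PreRep K) :=
  isRep_of_T_eq_one (by simp [IsRightRep, leg12_one, leg13_one]) ⟨1, isBraidingUnitary_one⟩ rfl

theorem isRep_regularRep : B.IsRep B.regularRep :=
  isRep_of_T_eq_one B.pentagon ⟨_, B.leftRep.isBraidingUnitary⟩ rfl

theorem isRep_braidedRegularRep : B.IsRep B.braidedRegularRep where
  rightRep := B.rightRep
  hasBraiding := B.hasBraiding
  equivariant := B.equivariant_right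
  braidedRep := B.braidedPentagon

theorem tensorRep_triv_of_T_eq_one {x : B.PreRep K₂} (hx : x.T = 1) :
    B.tensorRep (⟨1, 1⟩ : B.PreRep K₁) x = ⟨leg23 K₁ x.S, 1⟩ := by
  ext1
  · simp [tensorRep_S, leg13_one]
  · simp [tensorRep_T, leg13_one, leg23_one, hx]

/-- On K₁ ⊗ K₂ ⊗ L ⊗ H, (T₁)₁₃ commutes with (S₁)₁₄ U₃₄ and with (S₂)₂₄, hence with the product in
which U₃₄ stands between (S₁)₁₄ and (S₂)₂₄. Conjugation by Z₂₃ moves U₃₄ to the end, and (T₂)₂₃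
commutes with that product. -/
theorem tensorRep_equivariant [Nontrivial H] {x₁ : B.PreRep K₁} {x₂ : B.PreRep K₂}
    (h₁ : B.IsRep x₁) (h₂ : B.IsRep x₂) :
    leg13 L (B.tensorRep x₁ x₂).S * leg23 (HTensor K₁ K₂) B.U *
        leg12 H (B.tensorRep x₁ x₂).T =
      leg12 H (B.tensorRep x₁ x₂).T *
        (leg13 L (B.tensorRep x₁ x₂).S * leg23 (HTensor K₁ K₂) B.U) := by
  have eZ := congrArg (leg234 K₁)
    (h₂.isBraidingUnitary.equivariant h₂.rightRep B.yetterDrinfeld)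
  have e₁ := congrArg (leg134 K₂) h₁.equivariant
  have e₂ := congrArg (leg234 K₁) h₂.equivariant
  simp only [leg134_mul, leg134_leg12, leg134_leg13, leg134_leg23] at e₁
  simp only [leg234_mul, leg234_leg12, leg234_leg13, leg234_leg23] at e₂ eZ
  simp only [tensorRep_S, tensorRep_T, leg12_mul, leg13_mul, leg12_inv]
  have c₁ := commute_leg14_leg23 x₁.S (braidingUnitary B.V x₂.S)
  have c₂ := commute_leg14_leg23 x₁.S x₂.T
  have c₃ := commute_leg13_leg24 x₁.T x₂.S
  generalize leg13 L (leg13 K₂ x₁.S) = s1, leg13 L (leg23 K₁ x₂.S) = s2,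
    leg23 (HTensor K₁ K₂) B.U = y, leg12 H (leg13 K₂ x₁.T) = t, leg12 H (leg23 K₁ x₂.T) = r,
    leg12 H (leg23 K₁ (braidingUnitary B.V x₂.S)) = z at *
  have hz : SemiconjBy z (s1 * (y * s2)) (s1 * (s2 * y)) :=
    SemiconjBy.mul_right c₁.symm (Eq.symm eZ)
  have ht : SemiconjBy t (s1 * (y * s2)) (s1 * (y * s2)) := by
    rw [← mul_assoc]
    exact SemiconjBy.mul_right (Eq.symm e₁) c₃
  have hr : SemiconjBy r (s1 * (s2 * y)) (s1 * (s2 * y)) :=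
    SemiconjBy.mul_right c₂.symm (Eq.symm e₂)
  rw [mul_assoc s1]
  exact (((hz.mul_left ht).mul_left hz.inv_symm_left).mul_left hr).eq.symm

/-- The braided conditions for T₁ and T₂ are applied in turn as F₃₄ moves to the right. Three facts
about the braiding of x₂ align the conjugations: its compatibility with F, the Yang–Baxter equation,
and its naturality for the equivariant unitary T₂. -/
theorem tensorRep_braidedRep [Nontrivial H] {x₁ : B.PreRep K₁} {x₂ : B.PreRep K₂}
    (h₁ : B.IsRep x₁) (h₂ : B.IsRep x₂) :
    leg23 (HTensor K₁ K₂) B.F * leg12 L (B.tensorRep x₁ x₂).T =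
      leg12 L (B.tensorRep x₁ x₂).T *
        conjBy (leg23 (HTensor K₁ K₂) (braiding B.V B.U)) (leg12 L (B.tensorRep x₁ x₂).T) *
          leg23 (HTensor K₁ K₂) B.F := by
  rw [braiding, conjBy_leg23_flip_trans]
  have eF := congrArg (leg234 K₁) (h₂.isBraidingUnitary.commute_leg23 B.equivariant_left)
  have eY := congrArg (leg234 K₁) (h₂.isBraidingUnitary.yangBaxter h₂.rightRep
    isBraidingUnitary_U B.yetterDrinfeld)
  have eT := congrArg (leg234 K₁) (h₂.isBraidingUnitary.commute_leg12
    isBraidingUnitary_U h₂.equivariant)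
  have e₁ := congrArg (leg134 K₂) h₁.leg23_mul_leg12
  have e₂ := congrArg (leg234 K₁) h₂.leg23_mul_leg12
  simp only [leg134_mul, leg134_inv, leg134_leg12, leg134_leg13, leg134_leg23] at e₁
  simp only [leg234_mul, leg234_inv, leg234_leg12, leg234_leg13, leg234_leg23] at e₂ eF eY eT
  simp only [tensorRep_T, leg12_mul, leg13_mul, leg12_inv, leg13_inv]
  have c₁ := commute_leg13_leg24 x₁.T (braidingUnitary B.V x₂.S)
  have c₂ := commute_leg14_leg23 x₁.T (braidingUnitary B.V x₂.S)
  have c₃ := commute_leg14_leg23 x₁.T x₂.T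
  generalize leg12 L (leg23 K₁ (braidingUnitary B.V x₂.S)) = z3,
    leg13 L (leg23 K₁ (braidingUnitary B.V x₂.S)) = z4,
    leg23 (HTensor K₁ K₂) (braidingUnitary B.V B.U) = y, leg23 (HTensor K₁ K₂) B.F = f,
    leg12 L (leg13 K₂ x₁.T) = t3, leg13 L (leg13 K₂ x₁.T) = t4,
    leg12 L (leg23 K₁ x₂.T) = r3, leg13 L (leg23 K₁ x₂.T) = r4 at *
  have hf : f * (z3 * z4)⁻¹ = (z3 * z4)⁻¹ * f := (Commute.inv_right (show Commute f _ from eF)).eq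
  have hr : (y * z4)⁻¹ * r3 = r3 * (y * z4)⁻¹ :=
    (Commute.inv_right (show Commute r3 _ from eT)).eq.symm
  have hy : z4 * y * z3⁻¹ = z3⁻¹ * (y * z4) := by
    rw [mul_inv_eq_iff_eq_mul, mul_assoc, eq_inv_mul_iff_mul_eq, eY, mul_assoc]
  have ht : t4 * (z3⁻¹ * r3) = z3⁻¹ * r3 * t4 := (c₂.inv_right.mul_right c₃).eq
  -- Since `t3` and `z4` act on disjoint legs, `t3` may be conjugated by `z3 * z4` instead of `z3`;
  -- unlike `z3` alone, this product is known to commute with `f`.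
  calc f * (z3 * t3 * z3⁻¹ * r3)
      = f * (z3 * (t3 * z4) * z4⁻¹ * z3⁻¹ * r3) := by group
    _ = f * (z3 * z4) * t3 * (z3 * z4)⁻¹ * r3 := by rw [c₁.eq]; group
    _ = z3 * z4 * (f * t3) * (z3 * z4)⁻¹ * r3 := by rw [eF]; group
    _ = z3 * z4 * t3 * y * t4 * y⁻¹ * (f * (z3 * z4)⁻¹) * r3 := by rw [e₁]; group
    _ = z3 * z4 * t3 * y * t4 * (z3 * (z4 * y))⁻¹ * (f * r3) := by rw [hf]; group
    _ = z3 * (z4 * t3) * y * t4 * z3⁻¹ * ((y * z4)⁻¹ * r3) * y * r4 * y⁻¹ * f := by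
      rw [e₂, eY]; group
    _ = z3 * t3 * z4 * y * (t4 * (z3⁻¹ * r3)) * z4⁻¹ * r4 * y⁻¹ * f := by
      rw [hr, ← c₁.eq]; group
    _ = z3 * t3 * (z4 * y * z3⁻¹) * r3 * t4 * z4⁻¹ * r4 * y⁻¹ * f := by rw [ht]; group
    _ = z3 * t3 * z3⁻¹ * (y * z4 * r3) * t4 * z4⁻¹ * r4 * y⁻¹ * f := by rw [hy]; group
    _ = z3 * t3 * z3⁻¹ * r3 * (y * (z4 * t4 * z4⁻¹ * r4) * y⁻¹) * f := by rw [← eT]; group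

theorem IsRep.isBraidingUnitary_tensor {x₁ : B.PreRep K₁} {x₂ : B.PreRep K₂}
    (h₁ : B.IsRep x₁) (h₂ : B.IsRep x₂) :
    IsBraidingUnitary B.V (B.tensorRep x₁ x₂).S
      (leg23 K₁ (braidingUnitary B.V x₂.S) * leg13 K₂ (braidingUnitary B.V x₁.S)) :=
  h₁.isBraidingUnitary.tensor h₂.isBraidingUnitary

/-- The tensor product of representations is a representation. -/
theorem IsRep.tensor [Nontrivial H] {x₁ : B.PreRep K₁} {x₂ : B.PreRep K₂}
    (h₁ : B.IsRep x₁) (h₂ : B.IsRep x₂) : B.IsRep (B.tensorRep x₁ x₂) where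
  rightRep := h₁.rightRep.tensor h₂.rightRep
  hasBraiding := ⟨_, h₁.isBraidingUnitary_tensor h₂⟩
  equivariant := tensorRep_equivariant h₁ h₂
  braidedRep := tensorRep_braidedRep h₁ h₂

end

end BraidedMultiplicativeUnitary

/-! ### Associators on four legs, slices and weak closedness. -/

namespace HTensor

noncomputable section

variable {A B C D A' : Type*}
  [NormedAddCommGroup A] [InnerProductSpace ℂ A]
  [NormedAddCommGroup B] [InnerProductSpace ℂ B]
  [NormedAddCommGroup C] [InnerProductSpace ℂ C]
  [NormedAddCommGroup D] [InnerProductSpace ℂ D]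
  [NormedAddCommGroup A'] [InnerProductSpace ℂ A']

/-! ### Associators and leg numbering -/

theorem toOp_leg12 (T : HTensor A B ≃ₗᵢ[ℂ] HTensor A B) :
    toOp (leg12 C T) = map (toOp T) (ContinuousLinearMap.id ℂ C) :=
  toOp_congr _ _

theorem map_assoc_swap_swap (p : HTensor A D) (b : B) (c : C) :
    map (toOp (assoc A B C)) (ContinuousLinearMap.id ℂ D)
        (swap (HTensor A B) C D (tmul (swap A B D (tmul p b)) c)) =
      swap A (HTensor B C) D (tmul p (tmul b c)) := by
  induction p using HTensor.induction_on with
  | closed => exact isClosed_eq (by fun_prop) (by fun_prop)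
  | add x y hx hy => simp only [add_tmul, map_add, hx, hy]
  | tmul a d =>
    simp only [swap_tmul, map_tmul, toOp_apply, assoc_tmul, ContinuousLinearMap.id_apply]

theorem map_assoc_swap_assoc_symm (a : A) (p : HTensor B D) (c : C) :
    map (toOp (assoc A B C)) (ContinuousLinearMap.id ℂ D)
        (swap (HTensor A B) C D (tmul ((assoc A B D).symm (tmul a p)) c)) =
      (assoc A (HTensor B C) D).symm (tmul a (swap B C D (tmul p c))) := by
  induction p using HTensor.induction_on with
  | closed => exact isClosed_eq (by fun_prop) (by fun_prop)
  | add x y hx hy => simp only [add_tmul, tmul_add, map_add, hx, hy]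
  | tmul b d =>
    simp only [swap_tmul, map_tmul, toOp_apply, assoc_tmul, assoc_symm_tmul,
      ContinuousLinearMap.id_apply]

theorem map_assoc_assoc_symm (a : A) (b : B) (q : HTensor C D) :
    map (toOp (assoc A B C)) (ContinuousLinearMap.id ℂ D)
        ((assoc (HTensor A B) C D).symm (tmul (tmul a b) q)) =
      (assoc A (HTensor B C) D).symm (tmul a ((assoc B C D).symm (tmul b q))) := by
  induction q using HTensor.induction_on with
  | closed => exact isClosed_eq (by fun_prop) (by fun_prop)
  | add x y hx hy => simp only [tmul_add, map_add, hx, hy]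
  | tmul c d =>
    simp only [map_tmul, toOp_apply, assoc_tmul, assoc_symm_tmul,
      ContinuousLinearMap.id_apply]

theorem intertwines_assoc_leg14 (T : HTensor A D ≃ₗᵢ[ℂ] HTensor A D) :
    Intertwines (map (toOp (assoc A B C)) (ContinuousLinearMap.id ℂ D))
      (leg13 C (leg13 B T)) (leg13 (HTensor B C) T) :=
  clm_ext_left (swap A B D) (swap (HTensor A B) C D) fun p b c => by
    simp only [ContinuousLinearMap.comp_apply, toOp_apply, leg13_swap, map_assoc_swap_swap]

theorem intertwines_assoc_leg24 (T : HTensor B D ≃ₗᵢ[ℂ] HTensor B D) :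
    Intertwines (map (toOp (assoc A B C)) (ContinuousLinearMap.id ℂ D))
      (leg13 C (leg23 A T)) (leg23 A (leg13 C T)) :=
  clm_ext_left (assoc A B D).symm (swap (HTensor A B) C D) fun a p c => by
    simp only [ContinuousLinearMap.comp_apply, toOp_apply, leg13_swap, leg23_assoc_symm,
      map_assoc_swap_assoc_symm]

theorem intertwines_assoc_leg34 (T : HTensor C D ≃ₗᵢ[ℂ] HTensor C D) :
    Intertwines (map (toOp (assoc A B C)) (ContinuousLinearMap.id ℂ D))
      (leg23 (HTensor A B) T) (leg23 A (leg23 B T)) :=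
  clm_ext_left (LinearIsometryEquiv.refl ℂ _) (assoc (HTensor A B) C D).symm fun a b q => by
    simp only [LinearIsometryEquiv.coe_refl, id_eq, ContinuousLinearMap.comp_apply, toOp_apply,
      leg23_assoc_symm, map_assoc_assoc_symm]

/-! ### Slices and weak closedness -/

theorem eq_of_inner_tmul {x y : HTensor A B}
    (h : ∀ a b, inner ℂ (tmul a b) x = inner ℂ (tmul a b) y) : x = y := by
  refine ext_inner_left ℂ fun z => ?_
  induction z using HTensor.induction_on with
  | closed => exact isClosed_eq (by fun_prop) (by fun_prop)
  | add u v hu hv => rw [inner_add_left, inner_add_left, hu, hv]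
  | tmul a b => exact h a b

theorem adjoint_tmulRight_tmul [CompleteSpace A] (x : A) (y z : B) :
    ContinuousLinearMap.adjoint (tmulRight A y) (tmul x z) = (inner ℂ y z : ℂ) • x := by
  refine ext_inner_left ℂ fun u => ?_
  rw [ContinuousLinearMap.adjoint_inner_right, tmulRight_apply, inner_tmul, inner_smul_right,
    mul_comm]

/-- The adjoint of `tmulRight` slices off the second factor, and operators on the first factor pass
through the slice. -/
theorem adjoint_tmulRight_map [CompleteSpace A] [CompleteSpace A']
    (a : A →L[ℂ] A') (y : B) (w : HTensor A B) :
    ContinuousLinearMap.adjoint (tmulRight A' y) (map a (ContinuousLinearMap.id ℂ B) w) =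
      a (ContinuousLinearMap.adjoint (tmulRight A y) w) := by
  induction w using HTensor.induction_on with
  | closed => exact isClosed_eq (by fun_prop) (by fun_prop)
  | add u v hu hv => simp only [map_add, hu, hv]
  | tmul x z =>
    rw [map_tmul, adjoint_tmulRight_tmul, adjoint_tmulRight_tmul, map_smul,
      ContinuousLinearMap.id_apply]

/-- An operator `a ⊗ 1` intertwines two unitaries if and only if `a` intertwines their slices. -/
theorem intertwines_map_id_iff [CompleteSpace A] [CompleteSpace A']
    {a : A →L[ℂ] A'} {X : HTensor A B ≃ₗᵢ[ℂ] HTensor A B}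
    {Y : HTensor A' B ≃ₗᵢ[ℂ] HTensor A' B} :
    Intertwines (map a (ContinuousLinearMap.id ℂ B)) X Y ↔ ∀ (x : A) (y : B) (x' : A') (y' : B),
      inner ℂ x' (a (ContinuousLinearMap.adjoint (tmulRight A y') (X (tmul x y)))) =
        inner ℂ (ContinuousLinearMap.adjoint (tmulRight A' y) (Y.symm (tmul x' y'))) (a x) := by
  have h₁ : ∀ (x : A) (y : B) (x' : A') (y' : B),
      inner ℂ x' (a (ContinuousLinearMap.adjoint (tmulRight A y') (X (tmul x y)))) =
        inner ℂ (tmul x' y') (map a (ContinuousLinearMap.id ℂ B) (X (tmul x y))) := by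
    intro x y x' y'
    rw [← adjoint_tmulRight_map, ContinuousLinearMap.adjoint_inner_right, tmulRight_apply]
  have h₂ : ∀ (x : A) (y : B) (x' : A') (y' : B),
      inner ℂ (ContinuousLinearMap.adjoint (tmulRight A' y) (Y.symm (tmul x' y'))) (a x) =
        inner ℂ (tmul x' y') (Y (map a (ContinuousLinearMap.id ℂ B) (tmul x y))) := by
    intro x y x' y'
    rw [ContinuousLinearMap.adjoint_inner_left, tmulRight_apply, map_tmul,
      ContinuousLinearMap.id_apply, ← LinearIsometryEquiv.inner_map_map Y,
      LinearIsometryEquiv.apply_symm_apply]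
  simp only [h₁, h₂]
  exact ⟨fun h x y x' y' => by rw [h.apply],
    fun h => clm_ext fun x y => eq_of_inner_tmul fun x' y' => h x y x' y'⟩

/-- A matrix coefficient of a ⊗ 1 at a general tensor need not depend on a weakly continuously.
Between elementary tensors, however, the relation only involves slices of X and Y⁻¹, so each
condition equates two matrix coefficients of a at fixed vectors. -/
theorem isClosed_setOf_intertwines [CompleteSpace A] [CompleteSpace A']
    (X : HTensor A B ≃ₗᵢ[ℂ] HTensor A B) (Y : HTensor A' B ≃ₗᵢ[ℂ] HTensor A' B) :
    IsClosed {a : A →WOT[ℂ] A' |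
      Intertwines (map a.toCLM (ContinuousLinearMap.id ℂ B)) X Y} := by
  simp only [intertwines_map_id_iff, Set.ofPred_forall]
  refine isClosed_iInter fun x => isClosed_iInter fun y => isClosed_iInter fun x' =>
    isClosed_iInter fun y' => isClosed_eq ?_ ?_
  · exact ContinuousLinearMapWOT.continuous_dual_apply _ (innerSL ℂ x')
  · exact ContinuousLinearMapWOT.continuous_dual_apply _ (innerSL ℂ _)

end

end HTensor

/-! ### The tensor category of representations and its natural right absorber. -/

namespace BraidedMultiplicativeUnitary

noncomputable section

variable {H L : Type u}
  [NormedAddCommGroup H] [InnerProductSpace ℂ H]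
  [NormedAddCommGroup L] [InnerProductSpace ℂ L]
  {B : BraidedMultiplicativeUnitary H L}
  {K K₁ K₂ K₃ K₁' K₂' Y : Type u}
  [NormedAddCommGroup K] [InnerProductSpace ℂ K]
  [NormedAddCommGroup K₁] [InnerProductSpace ℂ K₁]
  [NormedAddCommGroup K₂] [InnerProductSpace ℂ K₂]
  [NormedAddCommGroup K₃] [InnerProductSpace ℂ K₃]
  [NormedAddCommGroup K₁'] [InnerProductSpace ℂ K₁']
  [NormedAddCommGroup K₂'] [InnerProductSpace ℂ K₂']
  [NormedAddCommGroup Y] [InnerProductSpace ℂ Y]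

theorem mem_intertwiner_iff {x₁ : B.PreRep K₁} {x₂ : B.PreRep K₂} {a : K₁ →L[ℂ] K₂} :
    a ∈ B.Intertwiner x₁ x₂ ↔
      Intertwines (HTensor.map a (ContinuousLinearMap.id ℂ H)) x₁.S x₂.S ∧
        Intertwines (HTensor.map a (ContinuousLinearMap.id ℂ L)) x₁.T x₂.T :=
  Iff.rfl

theorem id_mem_intertwiner (x : B.PreRep K) :
    ContinuousLinearMap.id ℂ K ∈ B.Intertwiner x x :=
  ⟨intertwines_map_id_id _, intertwines_map_id_id _⟩

theorem comp_mem_intertwiner {x₁ : B.PreRep K₁} {x₂ : B.PreRep K₂} {x₃ : B.PreRep K₃}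
    {a : K₁ →L[ℂ] K₂} {b : K₂ →L[ℂ] K₃} (ha : a ∈ B.Intertwiner x₁ x₂)
    (hb : b ∈ B.Intertwiner x₂ x₃) : b ∘L a ∈ B.Intertwiner x₁ x₃ := by
  have h : ∀ (E : Type u) [NormedAddCommGroup E] [InnerProductSpace ℂ E],
      HTensor.map (b ∘L a) (ContinuousLinearMap.id ℂ E) =
        HTensor.map b (ContinuousLinearMap.id ℂ E) ∘L
          HTensor.map a (ContinuousLinearMap.id ℂ E) := by
    intro E _ _
    rw [map_comp_map, ContinuousLinearMap.id_comp]
  rw [mem_intertwiner_iff] at *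
  rw [h, h]
  exact ⟨ha.1.comp hb.1, ha.2.comp hb.2⟩

theorem adjoint_mem_intertwiner [CompleteSpace H] [CompleteSpace L] [CompleteSpace K₁]
    [CompleteSpace K₂] {x₁ : B.PreRep K₁} {x₂ : B.PreRep K₂} {a : K₁ →L[ℂ] K₂}
    (ha : a ∈ B.Intertwiner x₁ x₂) :
    ContinuousLinearMap.adjoint a ∈ B.Intertwiner x₂ x₁ := by
  have h : ∀ (E : Type u) [NormedAddCommGroup E] [InnerProductSpace ℂ E] [CompleteSpace E],
      HTensor.map (ContinuousLinearMap.adjoint a) (ContinuousLinearMap.id ℂ E) =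
        ContinuousLinearMap.adjoint (HTensor.map a (ContinuousLinearMap.id ℂ E)) := by
    intro E _ _ _
    rw [adjoint_map, ContinuousLinearMap.adjoint_id]
  rw [mem_intertwiner_iff] at *
  rw [h, h]
  exact ⟨ha.1.adjoint, ha.2.adjoint⟩

/-- Tensor products of intertwiners are intertwiners. -/
theorem map_mem_intertwiner [Nontrivial H] {x₁ : B.PreRep K₁} {x₂ : B.PreRep K₂}
    {x₁' : B.PreRep K₁'} {x₂' : B.PreRep K₂'} (h₂ : HasBraiding B.V x₂.S)
    (h₂' : HasBraiding B.V x₂'.S) {a : K₁ →L[ℂ] K₁'} {b : K₂ →L[ℂ] K₂'}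
    (ha : a ∈ B.Intertwiner x₁ x₁') (hb : b ∈ B.Intertwiner x₂ x₂') :
    HTensor.map a b ∈ B.Intertwiner (B.tensorRep x₁ x₂) (B.tensorRep x₁' x₂') := by
  rw [mem_intertwiner_iff] at *
  rw [tensorRep_S, tensorRep_S, tensorRep_T, tensorRep_T]
  have hZ := (isBraidingUnitary_braidingUnitary h₂).intertwines
    (isBraidingUnitary_braidingUnitary h₂') hb.1
  exact ⟨(ha.1.leg13 b).mul (hb.1.leg23 a),
    (((hZ.leg23 a).mul (ha.2.leg13 b)).mul (hZ.leg23 a).inv).mul (hb.2.leg23 a)⟩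

/-- The associator is an intertwiner. -/
theorem assoc_mem_intertwiner [Nontrivial H] {x₁ : B.PreRep K₁} {x₂ : B.PreRep K₂}
    {x₃ : B.PreRep K₃} (h₂ : B.IsRep x₂) (h₃ : B.IsRep x₃) :
    toOp (HTensor.assoc K₁ K₂ K₃) ∈ B.Intertwiner
      (B.tensorRep (B.tensorRep x₁ x₂) x₃) (B.tensorRep x₁ (B.tensorRep x₂ x₃)) := by
  rw [mem_intertwiner_iff]
  constructor
  · simp only [tensorRep_S, leg13_mul, leg23_mul]
    rw [← mul_assoc]
    exact ((intertwines_assoc_leg14 x₁.S).mul (intertwines_assoc_leg24 x₂.S)).mul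
      (intertwines_assoc_leg34 x₃.S)
  -- The braiding unitary chosen for x₂ ⊗ x₃ is the hexagon product, by uniqueness. After this
  -- substitution both triple products are the same word, up to cancelling `z⁻¹ * z`.
  · rw [tensorRep_T x₁, (h₂.isBraidingUnitary_tensor h₃).braidingUnitary_eq]
    simp only [tensorRep_T, leg13_mul, leg23_mul, leg13_inv, leg23_inv]
    generalize hz : leg23 K₁ (leg23 K₂ (braidingUnitary B.V x₃.S)) = z
    have e₁ := intertwines_assoc_leg14 (B := K₂) (C := K₃) x₁.T
    have e₂ := intertwines_assoc_leg24 (A := K₁) (C := K₃) x₂.T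
    have e₃ := intertwines_assoc_leg34 (A := K₁) (B := K₂) x₃.T
    have f₂ := intertwines_assoc_leg24 (A := K₁) (C := K₃) (braidingUnitary B.V x₂.S)
    have f₃ := intertwines_assoc_leg34 (A := K₁) (B := K₂) (braidingUnitary B.V x₃.S)
    rw [hz] at f₃
    convert ((f₃.mul (((f₂.mul e₁).mul f₂.inv).mul e₂)).mul f₃.inv).mul e₃ using 1
    group

theorem tensorRep_triv_triv :
    B.tensorRep (⟨1, 1⟩ : B.PreRep K₁) (⟨1, 1⟩ : B.PreRep K₂) = ⟨1, 1⟩ := by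
  rw [tensorRep_triv_of_T_eq_one rfl, leg23_one]

theorem leftUnit_mem_intertwiner (x : B.PreRep K) :
    TensorData.leftUnit K ∈ B.Intertwiner x (B.tensorRep ⟨1, 1⟩ x) := by
  have h : ∀ (E : Type u) [NormedAddCommGroup E] [InnerProductSpace ℂ E] (p : HTensor K E),
      HTensor.map (TensorData.leftUnit K) (ContinuousLinearMap.id ℂ E) p =
        (HTensor.assoc _ K E).symm (tmul TensorData.unitVec p) := by
    intro E _ _ p
    induction p using HTensor.induction_on with
    | closed => exact isClosed_eq (by fun_prop) (by fun_prop)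
    | add u v hu hv => simp only [tmul_add, map_add, hu, hv]
    | tmul k e =>
      rw [map_tmul, assoc_symm_tmul]
      rfl
  rw [mem_intertwiner_iff, tensorRep_S, tensorRep_T, leg13_one, leg13_one, one_mul, mul_one,
    mul_inv_cancel, one_mul]
  constructor <;>
  · ext p
    simp only [ContinuousLinearMap.comp_apply, toOp_apply, h, leg23_assoc_symm]

/-- The trivial representation has braiding unitary 1, so the conjugation in ⊤ disappears.
Uniqueness is needed because `braidingUnitary` is only a choice. -/
theorem rightUnit_mem_intertwiner [Nontrivial H] (x : B.PreRep K) :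
    TensorData.rightUnit K ∈ B.Intertwiner x (B.tensorRep x ⟨1, 1⟩) := by
  have h : ∀ (E : Type u) [NormedAddCommGroup E] [InnerProductSpace ℂ E] (p : HTensor K E),
      HTensor.map (TensorData.rightUnit K) (ContinuousLinearMap.id ℂ E) p =
        swap K _ E (tmul p TensorData.unitVec) := by
    intro E _ _ p
    induction p using HTensor.induction_on with
    | closed => exact isClosed_eq (by fun_prop) (by fun_prop)
    | add u v hu hv => simp only [add_tmul, map_add, hu, hv]
    | tmul k e =>
      rw [map_tmul, swap_tmul]
      rfl
  rw [mem_intertwiner_iff, tensorRep_S, tensorRep_T, isBraidingUnitary_one.braidingUnitary_eq,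
    leg23_one, leg23_one, inv_one, one_mul, mul_one, mul_one, mul_one]
  constructor <;>
  · ext p
    simp only [ContinuousLinearMap.comp_apply, toOp_apply, h, leg13_swap]

/-- The factors coming from y, including its braiding unitary, do not touch the first leg and so are
intertwined by a ⊗ 1. They can be stripped off, leaving S and T on legs 1 and 3. -/
theorem mem_intertwiner_of_map_id_right [Nontrivial Y] {x₁ : B.PreRep K₁} {x₂ : B.PreRep K₂}
    {y : B.PreRep Y} {a : K₁ →L[ℂ] K₂}
    (h : HTensor.map a (ContinuousLinearMap.id ℂ Y) ∈
      B.Intertwiner (B.tensorRep x₁ y) (B.tensorRep x₂ y)) : a ∈ B.Intertwiner x₁ x₂ := by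
  rw [mem_intertwiner_iff, tensorRep_S, tensorRep_S, tensorRep_T, tensorRep_T] at h
  have hZ := (intertwines_map_id_id (braidingUnitary B.V y.S)).leg23 a
  exact ⟨(h.1.of_mul_right ((intertwines_map_id_id y.S).leg23 a)).of_leg13,
    (((h.2.of_mul_right ((intertwines_map_id_id y.T).leg23 a)).of_mul_right
      hZ.inv).of_mul_left hZ).of_leg13⟩

/-- The order matters: the braiding unitaries now belong to x₁ and x₂, so a must first be shown to
intertwine the S-parts. Naturality then allows the braiding to be cancelled from the T-parts. -/
theorem mem_intertwiner_of_map_id_left [Nontrivial H] [Nontrivial Y] {x₁ : B.PreRep K₁}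
    {x₂ : B.PreRep K₂} (h₁ : HasBraiding B.V x₁.S) (h₂ : HasBraiding B.V x₂.S)
    {y : B.PreRep Y} {a : K₁ →L[ℂ] K₂}
    (h : HTensor.map (ContinuousLinearMap.id ℂ Y) a ∈
      B.Intertwiner (B.tensorRep y x₁) (B.tensorRep y x₂)) : a ∈ B.Intertwiner x₁ x₂ := by
  rw [mem_intertwiner_iff, tensorRep_S, tensorRep_S, tensorRep_T, tensorRep_T] at h
  have hS := (h.1.of_mul_left ((intertwines_map_id_id y.S).leg13 a)).of_leg23
  have hZ := ((isBraidingUnitary_braidingUnitary h₁).intertwines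
    (isBraidingUnitary_braidingUnitary h₂) hS).leg23 (ContinuousLinearMap.id ℂ Y)
  exact ⟨hS, (h.2.of_mul_left
    ((hZ.mul ((intertwines_map_id_id y.T).leg13 a)).mul hZ.inv)).of_leg23⟩

/-- The representations of a braided multiplicative unitary form a Hilbert space tensor
category. -/
theorem isHilbertSpaceTensorCategory_corep [CompleteSpace H] [CompleteSpace L] [Nontrivial H]
    (B : BraidedMultiplicativeUnitary H L) : B.corep.IsHilbertSpaceTensorCategory where
  id_mem _ := id_mem_intertwiner _
  comp_mem _ _ _ _ _ ha hb := comp_mem_intertwiner ha hb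
  zero_mem _ _ := by
    constructor <;> rw [map_zero_left, ContinuousLinearMap.zero_comp,
      ContinuousLinearMap.comp_zero]
  add_mem _ _ _ _ ha hb := by
    constructor <;> rw [map_add_left, ContinuousLinearMap.add_comp, ContinuousLinearMap.comp_add]
    · rw [ha.1, hb.1]
    · rw [ha.2, hb.2]
  smul_mem _ _ c _ ha := by
    constructor <;>
      rw [map_smul_left, ContinuousLinearMap.smul_comp, ContinuousLinearMap.comp_smul]
    · rw [ha.1]
    · rw [ha.2]
  adjoint_mem _ _ _ ha := adjoint_mem_intertwiner ha
  weakly_closed _ _ :=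
    (isClosed_setOf_intertwines _ _).inter (isClosed_setOf_intertwines _ _)
  eq_of_id_mem _ _ h := by
    have h₁ := h.1
    have h₂ := h.2
    rw [map_id_id] at h₁ h₂
    exact PreRep.ext (toOp_injective h₁) (toOp_injective h₂)
  isObj_triv _ _ _ _ := isRep_triv
  hom_triv a := ⟨intertwines_one _, intertwines_one _⟩
  isObj_tensor h₁ h₂ := IsRep.tensor h₁ h₂
  map_mem _ h₂ _ h₂' _ _ ha hb :=
    map_mem_intertwiner h₂.hasBraiding h₂'.hasBraiding ha hb
  tensor_triv K₁ K₂ := by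
    intros
    exact tensorRep_triv_triv
  assoc_mem _ h₂ h₃ := assoc_mem_intertwiner h₂ h₃
  leftUnit_mem _ := leftUnit_mem_intertwiner _
  rightUnit_mem _ := rightUnit_mem_intertwiner _
  cancel_right _ _ _ _ h := mem_intertwiner_of_map_id_right h
  cancel_left h₁ h₂ _ _ h := mem_intertwiner_of_map_id_left h₁.hasBraiding h₂.hasBraiding h

/-! ### The absorber -/

theorem isRep_absorber [Nontrivial H] : B.IsRep B.absorber :=
  isRep_regularRep.tensor isRep_braidedRegularRep

/-- For a representation `(K, S, T)`, the unitary `T` is an intertwiner from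
`(K, S, T) ⊗ (L, U, F)` to `(K, S, 1) ⊗ (L, U, F)`. -/
theorem T_mem_intertwiner {x : B.PreRep K} (hx : B.IsRep x) :
    toOp x.T ∈ B.Intertwiner (B.tensorRep x B.braidedRegularRep)
      (B.tensorRep ⟨x.S, 1⟩ B.braidedRegularRep) := by
  rw [mem_intertwiner_iff, ← toOp_leg12, ← toOp_leg12, intertwines_toOp_iff,
    intertwines_toOp_iff]
  refine ⟨hx.equivariant.symm, ?_⟩
  simp only [tensorRep_T, leg13_one, mul_one, mul_inv_cancel, one_mul]
  rw [← mul_assoc]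
  exact hx.leg23_mul_leg12.symm

/-- For a right representation `S` of `W`, the unitary `S` is an intertwiner from
`(K ⊗ H, S₁₃ W₂₃, 1)` to `(K, 1, 1) ⊗ (H, W, 1)`. -/
theorem S_mem_intertwiner {x : B.PreRep K} (hS : IsRightRep B.W x.S) :
    toOp x.S ∈ B.Intertwiner ⟨(B.tensorRep x B.regularRep).S, 1⟩
      (B.tensorRep ⟨1, 1⟩ B.regularRep) := by
  rw [tensorRep_triv_of_T_eq_one rfl, mem_intertwiner_iff, ← toOp_leg12, intertwines_toOp_iff]
  refine ⟨?_, intertwines_one _⟩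
  rw [tensorRep_S, ← mul_assoc]
  exact Eq.symm hS

theorem toOp_absorbing (x : B.PreRep K) :
    toOp (B.absorbing x) = toOp (HTensor.assoc K H L) ∘L (HTensor.map (toOp x.S)
      (ContinuousLinearMap.id ℂ L) ∘L (toOp (B.tensorRep x B.regularRep).T ∘L
        toOp (HTensor.assoc K H L).symm)) := by
  rw [← toOp_leg12]
  rfl

/-- The arrow is the composite x ⊗ ρ ≅ (x ⊗ (H, W, 1)) ⊗ (L, U, F) → (K ⊗ H, S₁₃W₂₃, 1) ⊗ (L, U, F)
→ (τ(K) ⊗ (H, W, 1)) ⊗ (L, U, F) ≅ τ(K) ⊗ ρ. The inverse associator is an arrow because it is the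
adjoint of one. -/
theorem absorbing_mem_intertwiner [CompleteSpace H] [CompleteSpace L] [CompleteSpace K]
    [Nontrivial H] {x : B.PreRep K} (hx : B.IsRep x) :
    toOp (B.absorbing x) ∈
      B.Intertwiner (B.tensorRep x B.absorber) (B.tensorRep ⟨1, 1⟩ B.absorber) := by
  have hα := adjoint_mem_intertwiner (assoc_mem_intertwiner (x₁ := x) (B := B)
    isRep_regularRep isRep_braidedRegularRep)
  rw [adjoint_toOp] at hα
  have hT := T_mem_intertwiner (hx.tensor (isRep_regularRep (B := B)))
  have hL : HasBraiding B.V B.braidedRegularRep.S := isRep_braidedRegularRep.hasBraiding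
  have hS := map_mem_intertwiner hL hL (S_mem_intertwiner hx.rightRep)
    (id_mem_intertwiner B.braidedRegularRep)
  rw [toOp_absorbing, absorber]
  exact comp_mem_intertwiner (comp_mem_intertwiner (comp_mem_intertwiner hα hT) hS)
    (assoc_mem_intertwiner isRep_regularRep isRep_braidedRegularRep)

/-- Both factors of A^x are natural: S₁₂ because a intertwines the S-parts, and T ⊤ 1 because a ⊗ 1
is an arrow between the tensor products with (H, W, 1). -/
theorem absorbing_natural [Nontrivial H] {x₁ : B.PreRep K₁} {x₂ : B.PreRep K₂}
    {a : K₁ →L[ℂ] K₂} (ha : a ∈ B.Intertwiner x₁ x₂) :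
    Intertwines (HTensor.map a (ContinuousLinearMap.id ℂ (HTensor H L)))
      (B.absorbing x₁) (B.absorbing x₂) := by
  rw [mem_intertwiner_iff] at ha
  have hT := (mem_intertwiner_iff.mp <| map_mem_intertwiner (B := B) isRep_regularRep.hasBraiding
    isRep_regularRep.hasBraiding ha (id_mem_intertwiner B.regularRep)).2
  have hM := (ha.1.leg12 (ContinuousLinearMap.id ℂ L)).mul hT
  have hα : ∀ z, HTensor.map a (ContinuousLinearMap.id ℂ (HTensor H L))
      (HTensor.assoc K₁ H L z) = HTensor.assoc K₂ H L (HTensor.map (HTensor.map a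
        (ContinuousLinearMap.id ℂ H)) (ContinuousLinearMap.id ℂ L) z) := by
    intro z
    exact congrArg (fun k => k z) (clm_ext₃
      (f := HTensor.map a (ContinuousLinearMap.id ℂ (HTensor H L)) ∘L
        toOp (HTensor.assoc K₁ H L))
      (g := toOp (HTensor.assoc K₂ H L) ∘L HTensor.map (HTensor.map a
        (ContinuousLinearMap.id ℂ H)) (ContinuousLinearMap.id ℂ L)) fun k h l => by
      simp only [ContinuousLinearMap.comp_apply, toOp_apply, assoc_tmul, map_tmul,
        ContinuousLinearMap.id_apply])
  ext w
  obtain ⟨z, rfl⟩ := (HTensor.assoc K₁ H L).surjective w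
  simp only [ContinuousLinearMap.comp_apply, toOp_apply, absorbing, conjBy,
    LinearIsometryEquiv.trans_apply, LinearIsometryEquiv.symm_apply_apply, hα]
  exact congrArg _ (hM.apply z)

theorem absorbing_tensorRep [Nontrivial H] {x₁ : B.PreRep K₁} {x₂ : B.PreRep K₂}
    (h₂ : B.IsRep x₂) :
    B.absorbing (B.tensorRep x₁ x₂) =
      leg13 K₂ (B.absorbing x₁) * leg23 K₁ (B.absorbing x₂) := by
  have e₁ : leg13 K₂ (B.absorbing x₁) = conjBy (HTensor.assoc (HTensor K₁ K₂) H L)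
      (leg134 K₂ (leg12 L x₁.S * (B.tensorRep x₁ B.regularRep).T)) := by
    rw [leg134, conjBy_conjBy_symm, absorbing]
  have e₂ : leg23 K₁ (B.absorbing x₂) = conjBy (HTensor.assoc (HTensor K₁ K₂) H L)
      (leg234 K₁ (leg12 L x₂.S * (B.tensorRep x₂ B.regularRep).T)) := by
    rw [leg234, conjBy_conjBy_symm, absorbing]
  rw [e₁, e₂, ← conjBy_mul, absorbing]
  congr 1
  have hV : braidingUnitary B.V B.regularRep.S = B.V⁻¹ :=
    B.leftRep.isBraidingUnitary.braidingUnitary_eq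
  have hT : B.regularRep.T = 1 := rfl
  have hZ := congrArg (leg234 K₁) (isBraidingUnitary_iff.mp h₂.isBraidingUnitary)
  simp only [leg234_mul, leg234_leg12, leg234_leg13, leg234_leg23] at hZ
  simp only [tensorRep_S, tensorRep_T, hV, hT, leg23_one, mul_one, leg23_inv, inv_inv,
    leg134_mul, leg234_mul, leg134_inv, leg234_inv, leg134_leg12, leg134_leg13, leg134_leg23,
    leg234_leg12, leg234_leg13, leg234_leg23, leg12_mul, leg13_mul, leg13_inv] at hZ ⊢
  have c := commute_leg14_leg23 (C := H) (D := L) x₁.T x₂.S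
  generalize leg12 L (leg13 K₂ x₁.S) = s1, leg12 L (leg23 K₁ x₂.S) = s2,
    leg23 (HTensor K₁ K₂) B.V = v, leg13 H (leg13 K₂ x₁.T) = t1, leg13 H (leg23 K₁ x₂.T) = t2,
    leg13 H (leg23 K₁ (braidingUnitary B.V x₂.S)) = z at *
  -- Both `hz` and `hz'` are forms of the equation defining `z`. They absorb the two braiding
  -- factors that surround `t1`, once `s2` has been moved past `t1` on disjoint legs.
  have hz : s2 * z⁻¹ = v * s2 * v⁻¹ := by rw [hZ]; group
  have hz' : s2 * v⁻¹ * z = v⁻¹ * s2 := by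
    have : z⁻¹ = s2⁻¹ * (v * s2 * v⁻¹) := by rw [← hz]; group
    rw [← inv_inv z, this]; group
  calc s1 * s2 * (v⁻¹ * (z * t1 * z⁻¹ * t2) * v)
      = s1 * (s2 * v⁻¹ * z) * t1 * z⁻¹ * t2 * v := by group
    _ = s1 * v⁻¹ * (s2 * t1) * z⁻¹ * t2 * v := by rw [hz']; group
    _ = s1 * v⁻¹ * t1 * (s2 * z⁻¹) * t2 * v := by rw [← c.eq]; group
    _ = s1 * (v⁻¹ * t1 * v) * (s2 * (v⁻¹ * t2 * v)) := by rw [hz]; group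

/-- The representation `ρ` with the unitaries `A x` is a natural right absorber. -/
theorem isNaturalRightAbsorber_absorber [CompleteSpace H] [CompleteSpace L] [Nontrivial H]
    (B : BraidedMultiplicativeUnitary H L) :
    B.corep.IsNaturalRightAbsorber B.absorber (fun x => B.absorbing x) where
  isObj := isRep_absorber
  mem_hom hx := absorbing_mem_intertwiner hx
  natural _ _ _ ha := absorbing_natural ha
  tensor _ h₂ := absorbing_tensorRep h₂

end

end BraidedMultiplicativeUnitary

theorem mainTheorem2 {H L : Type u}
    [NormedAddCommGroup H] [InnerProductSpace ℂ H] [CompleteSpace H] [Nontrivial H]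
    [NormedAddCommGroup L] [InnerProductSpace ℂ L] [CompleteSpace L]
    (B : BraidedMultiplicativeUnitary H L) :
    B.corep.IsHilbertSpaceTensorCategory ∧
      B.corep.IsNaturalRightAbsorber B.absorber (fun x => B.absorbing x) := by
  exact ⟨B.isHilbertSpaceTensorCategory_corep, B.isNaturalRightAbsorber_absorber⟩
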